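/- Let $\mathbf{Man}$ be the category of finite-dimensional smooth manifolds (Hausdorff, second countable, without boundary) and smooth maps. For $U\in\mathbf{Man}$ let $C^\infty_{\mathbb C,U}$ be the sheaf of smooth complex valued functions on $U$ and let $\mathbf{Sh}_{C^\infty_{\mathbb C}}(U)$ be the category of sheaves of $C^\infty_{\mathbb C,U}$-modules, with the relative tensor product $\otimes_{C^\infty_{\mathbb C,U}}$, the unit $C^\infty_{\mathbb C,U}$ and the involution $A\mapsto\overline A$, where $\overline A$ has the same sections as $A$ and functions act on it through their complex conjugates. For a smooth map $h:U\to V$ let $h^\ast A=h^{-1}A\otimes_{h^{-1}C^\infty_{\mathbb C,V}}C^\infty_{\mathbb C,U}$ be the inverse image, i.e. the left adjoint of the direct image functor $h_\ast$. Let ${}^\ast\mathbf{Alg}^\infty_{\mathbb C}(U)$ be the category of order-reversing $\ast$-monoids (associative unital $\ast$-algebras) in $\mathbf{Sh}_{C^\infty_{\mathbb C}}(U)$: its objects are quadruples $(A,\mu,\eta,\ast)$ that consist of a sheaf of modules $A$ and morphisms $\mu:A\otimes_{C^\infty_{\mathbb C,U}}A\to A$, $\eta:C^\infty_{\mathbb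 C,U}\to A$ and $\ast:A\to\overline A$ of sheaves of $C^\infty_{\mathbb C,U}$-modules such that, on sections over every open subset, $(ab)c=a(bc)$, $1a=a=a1$, $a^{\ast\ast}=a$, $1^\ast=1$ and $(ab)^\ast=b^\ast a^\ast$; its morphisms are the morphisms of sheaves of modules that preserve multiplications, units and involutions. For $h:U\to V$ the functor $h^\ast:{}^\ast\mathbf{Alg}^\infty_{\mathbb C}(V)\to{}^\ast\mathbf{Alg}^\infty_{\mathbb C}(U)$ is the inverse image of sheaves of modules, where $h^\ast A$ carries the structure maps obtained from those of $A$ through the canonical isomorphisms $h^\ast A\otimes h^\ast A\cong h^\ast(A\otimes A)$, $C^\infty_{\mathbb C,U}\cong h^\ast C^\infty_{\mathbb C,V}$ and $h^\ast\overline A\cong\overline{h^\ast A}$, i.e. $(a\otimes1)(b\otimes1)=ab\otimes1$, $1=1\otimes1$ and $(a\otimes 1)^\ast=a^\ast\otimes1$. With the canonical isomorphisms $(g\circ h)^\ast\cong h^\ast g^\ast$ and $\mathrm{id}^\ast\cong\mathrm{id}$ of inverse images this is a prestack, i.e. a pseudo-functor ${}^\ast\mathbf{Alg}^\infty_{\mathbb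 C}:\mathbf{Man}^{\mathrm{op}}\to\mathbf{Cat}$. Claim: ${}^\ast\mathbf{Alg}^\infty_{\mathbb C}$ is a stack for the open cover topology. That is, for every $U\in\mathbf{Man}$ and every open cover $\{U_\alpha\subseteq U\}$, the canonical functor $${}^\ast\mathbf{Alg}^\infty_{\mathbb C}(U)\longrightarrow{}^\ast\mathbf{Alg}^\infty_{\mathbb C}(\{U_\alpha\subseteq U\}),\qquad A\longmapsto\big(\{A|_{U_\alpha}\},\{\text{canonical isomorphisms}\}\big)$$ is an equivalence of categories. Here ${}^\ast\mathbf{Alg}^\infty_{\mathbb C}(\{U_\alpha\subseteq U\})$ is the descent category: its objects are families of objects $A_\alpha\in{}^\ast\mathbf{Alg}^\infty_{\mathbb C}(U_\alpha)$ with isomorphisms $\varphi_{\alpha\beta}:A_\beta|_{U_\alpha\cap U_\beta}\to A_\alpha|_{U_\alpha\cap U_\beta}$ in ${}^\ast\mathbf{Alg}^\infty_{\mathbb C}(U_\alpha\cap U_\beta)$ that satisfy, up to the coherence isomorphisms of the pseudo-functor, $\varphi_{\alpha\alpha}=\mathrm{id}$ and $\varphi_{\alpha\beta}\circ\varphi_{\beta\gamma}=\varphi_{\alpha\gamma}$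 on $U_\alpha\cap U_\beta\cap U_\gamma$ for all $\alpha,\beta,\gamma$; its morphisms are the families of morphisms $\psi_\alpha:A_\alpha\to A'_\alpha$ with $\varphi'_{\alpha\beta}\circ\psi_\beta|_{U_\alpha\cap U_\beta}=\psi_\alpha|_{U_\alpha\cap U_\beta}\circ\varphi_{\alpha\beta}$. -/

import Mathlib

open CategoryTheory TopologicalSpace Opposite
open scoped Manifold ContDiff

instance instContMDiffRingComplex : ContMDiffRing 𝓘(ℝ, ℂ) ∞ ℂ where
  contMDiff_add := by
    rw [← modelWithCornersSelf_prod, chartedSpaceSelf_prod]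
    exact contDiff_add.contMDiff
  contMDiff_mul := by
    rw [← modelWithCornersSelf_prod, chartedSpaceSelf_prod]
    exact contDiff_mul.contMDiff

noncomputable section

/-- A smooth manifold: finite-dimensional, Hausdorff and second countable, without boundary. -/
structure Man : Type 1 where
  carrier : Type
  dim : ℕ
  [top : TopologicalSpace carrier]
  [t2 : T2Space carrier]
  [sc : SecondCountableTopology carrier]
  [charted : ChartedSpace (EuclideanSpace ℝ (Fin dim)) carrier]
  [smooth : IsManifold (𝓡 dim) ∞ carrier]

namespace Man
attribute [instance] top t2 sc charted smooth

/-- Smooth maps. -/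
@[ext] structure Hom (U V : Man) where
  toFun : U.carrier → V.carrier
  contMDiff : ContMDiff (𝓡 U.dim) (𝓡 V.dim) ∞ toFun

/-- The category of manifolds and smooth maps. -/
instance : Category Man where
  Hom U V := Hom U V
  id U := ⟨id, contMDiff_id⟩
  comp f g := ⟨g.toFun ∘ f.toFun, g.contMDiff.comp f.contMDiff⟩

/-- The underlying topological space. -/
def toTop (U : Man) : TopCat := TopCat.of U.carrier
/-- The underlying continuous map. -/
def Hom.toTop {U V : Man} (h : U ⟶ V) : U.toTop ⟶ V.toTop := TopCat.ofHom ⟨h.toFun, h.contMDiff.continuous⟩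

/-- The sheaf of smooth complex valued functions, as a presheaf of commutative rings. -/
abbrev smoothPresheaf (U : Man) : (Opens U.toTop)ᵒᵖ ⥤ CommRingCat.{0} :=
  smoothPresheafCommRing (𝓡 U.dim) 𝓘(ℝ, ℂ) U.carrier ℂ

/-- The sheaf of rings of smooth complex valued functions. -/
abbrev O (U : Man) : Sheaf (Opens.grothendieckTopology U.toTop) RingCat.{0} :=
  ⟨U.smoothPresheaf ⋙ forget₂ CommRingCat RingCat,
   ((sheafCompose _ (forget₂ CommRingCat RingCat)).obj (smoothSheafCommRing (𝓡 U.dim) 𝓘(ℝ, ℂ) U.carrier ℂ)).property⟩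

/-- Precomposition of functions with `h`, as a morphism `C^∞_V ⟶ h_* C^∞_U` of sheaves of rings. -/
def Hom.onO {U V : Man} (h : U ⟶ V) :
    V.O ⟶ ((Opens.map (Hom.toTop h)).sheafPushforwardContinuous RingCat.{0} (Opens.grothendieckTopology V.toTop) (Opens.grothendieckTopology U.toTop)).obj U.O :=
  ⟨Functor.whiskerRight (ContMDiff.smoothSheafCommRingHom (R := ℂ) (I := 𝓘(ℝ, ℂ)) (IM := 𝓡 U.dim) (IP := 𝓡 V.dim) (f := h.toFun) (hf := h.contMDiff)).hom (forget₂ CommRingCat RingCat)⟩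

theorem onO_comp {U V W : Man} (h : U ⟶ V) (g : V ⟶ W) : Hom.onO (h ≫ g) = Hom.onO g ≫ ((Opens.map (Hom.toTop g)).sheafPushforwardContinuous RingCat.{0} (Opens.grothendieckTopology W.toTop) (Opens.grothendieckTopology V.toTop)).map (Hom.onO h) := rfl
theorem onO_id {U : Man} : Hom.onO (𝟙 U) = 𝟙 U.O := rfl

/-- The category of sheaves of modules over the sheaf of smooth complex valued functions. -/
abbrev Sh (U : Man) := SheafOfModules.{0} U.O

instance onO_isRightAdjoint {U V : Man} (h : U ⟶ V) : (PresheafOfModules.pushforward.{0} (F := Opens.map (Hom.toTop h)) (Hom.onO h).hom).IsRightAdjoint := PresheafOfModules.instIsRightAdjointPushforward (F := Opens.map (Hom.toTop h)) (Hom.onO h).hom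

/-- Direct image of sheaves of modules. -/
def push {U V : Man} (h : U ⟶ V) : U.Sh ⥤ V.Sh := SheafOfModules.pushforward (Hom.onO h)
/-- Inverse image of sheaves of modules, `h^* A = h⁻¹ A ⊗_{h⁻¹ C^∞_V} C^∞_U`, through its universal
property: the left adjoint of the direct image functor. -/
def pull {U V : Man} (h : U ⟶ V) : V.Sh ⥤ U.Sh := SheafOfModules.pullback (F := Opens.map (Hom.toTop h)) (Hom.onO h)
/-- Inverse image is left adjoint to direct image. -/
def pullPushAdj {U V : Man} (h : U ⟶ V) : pull h ⊣ push h := SheafOfModules.pullbackPushforwardAdjunction (F := Opens.map (Hom.toTop h)) (Hom.onO h)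

/-- Coherence isomorphism for the direct image along an identity. -/
def pushId (U : Man) : push (𝟙 U) ≅ 𝟭 _ := SheafOfModules.pushforwardId _
/-- Coherence isomorphism for the direct image along a composition. -/
def pushComp {U V W : Man} (h : U ⟶ V) (g : V ⟶ W) : push h ⋙ push g ≅ push (h ≫ g) := SheafOfModules.pushforwardComp _ _
/-- Coherence isomorphism for the inverse image along an identity. -/
def pullId (U : Man) : pull (𝟙 U) ≅ 𝟭 _ := SheafOfModules.pullbackId _
/-- Coherence isomorphism for the inverse image along a composition. -/
def pullComp {U V W : Man} (h : U ⟶ V) (g : V ⟶ W) : pull g ⋙ pull h ≅ pull (h ≫ g) :=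
  SheafOfModules.pullbackComp (F := Opens.map (Hom.toTop g)) (G := Opens.map (Hom.toTop h)) (Hom.onO g) (Hom.onO h)

theorem conjugateEquiv_pullId (U : Man) : conjugateEquiv .id (pullPushAdj (𝟙 U)) (pullId U).hom = (pushId U).inv :=
  SheafOfModules.conjugateEquiv_pullbackId_hom U.O
theorem conjugateEquiv_pullComp {U V W : Man} (h : U ⟶ V) (g : V ⟶ W) :
  conjugateEquiv ((pullPushAdj g).comp (pullPushAdj h)) (pullPushAdj (h ≫ g)) (pullComp h g).inv = (pushComp h g).hom :=
  SheafOfModules.conjugateEquiv_pullbackComp_inv (F := Opens.map (Hom.toTop g)) (G := Opens.map (Hom.toTop h)) (Hom.onO g) (Hom.onO h)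

/-- The smooth complex valued functions on an open subset. -/
abbrev Fn (U : Man) (W : Opens U.toTop) : Type := U.smoothPresheaf.obj (op W)

/-- Restriction of functions. -/
def fres {U : Man} {V W : Opens U.toTop} (h : V ≤ W) : U.Fn W →+* U.Fn V :=
  (U.smoothPresheaf.map (homOfLE h).op).hom

/-- Precomposition of functions with `h`. -/
def fpull {U V : Man} (h : U ⟶ V) (W : Opens V.toTop) : V.Fn W →+* U.Fn ((Opens.map (Hom.toTop h)).obj W) :=
  ((ContMDiff.smoothSheafCommRingHom (R := ℂ) (I := 𝓘(ℝ, ℂ)) (IM := 𝓡 U.dim) (IP := 𝓡 V.dim) (f := h.toFun) (hf := h.contMDiff)).hom.app (op W)).hom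

/-- Sections of a sheaf of modules. -/
def Sec {U : Man} (A : U.Sh) (W : Opens U.toTop) : Type := A.val.obj (op W)

variable {U : Man}

instance (A : U.Sh) (W : Opens U.toTop) : AddCommGroup (Sec A W) := inferInstanceAs (AddCommGroup (A.val.obj (op W)))
instance (A : U.Sh) (W : Opens U.toTop) : Module (U.Fn W) (Sec A W) := inferInstanceAs (Module (U.O.obj.obj (op W)) (A.val.obj (op W)))

/-- Restriction of sections. -/
def res (A : U.Sh) {V W : Opens U.toTop} (h : V ≤ W) : Sec A W →+ Sec A V :=
  (A.val.map (homOfLE h).op).hom.toAddMonoidHom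

theorem res_smul (A : U.Sh) {V W : Opens U.toTop} (h : V ≤ W) (f : U.Fn W) (a : Sec A W) :
    res A h (f • a) = fres h f • res A h a := (A.val.map (homOfLE h).op).hom.map_smul _ _

theorem res_res (A : U.Sh) {V W X : Opens U.toTop} (h : V ≤ W) (k : W ≤ X) (a : Sec A X) :
    res A h (res A k a) = res A (h.trans k) a :=
  (PresheafOfModules.map_comp_apply A.val (homOfLE k).op (homOfLE h).op a).symm

theorem res_self (A : U.Sh) {W : Opens U.toTop} (h : W ≤ W) (a : Sec A W) : res A h a = a :=
  DFunLike.congr_fun (congrArg (fun f => f) (congrArg ModuleCat.Hom.hom (A.val.map_id (op W)))) a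

/-- Action of a morphism on sections. -/
def ap {A B : U.Sh} (κ : A ⟶ B) (W : Opens U.toTop) : Sec A W →ₗ[U.Fn W] Sec B W := (κ.val.app (op W)).hom

theorem ap_res {A B : U.Sh} (κ : A ⟶ B) {V W : Opens U.toTop} (h : V ≤ W) (a : Sec A W) :
    ap κ V (res A h a) = res B h (ap κ W a) := PresheafOfModules.naturality_apply κ.val (homOfLE h).op a

@[ext] theorem hom_ext {A B : U.Sh} {κ τ : A ⟶ B} (h : ∀ W a, ap κ W a = ap τ W a) : κ = τ := by
  apply SheafOfModules.hom_ext
  ext W a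
  exact h W.unop a

@[simp] theorem ap_comp {A B C : U.Sh} (κ : A ⟶ B) (τ : B ⟶ C) (W : Opens U.toTop) (a : Sec A W) : ap (κ ≫ τ) W a = ap τ W (ap κ W a) := rfl
@[simp] theorem ap_id {A : U.Sh} (W : Opens U.toTop) (a : Sec A W) : ap (𝟙 A) W a = a := rfl

/-- A morphism from its action on sections. -/
def mkHom {A B : U.Sh} (φ : ∀ W, Sec A W →ₗ[U.Fn W] Sec B W)
    (hφ : ∀ V W (h : V ≤ W) a, φ V (res A h a) = res B h (φ W a)) : A ⟶ B where
  val :=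
  { app := fun W => ModuleCat.ofHom (X := A.val.obj W) (Y := B.val.obj W) (φ W.unop)
    naturality := fun {V W} i => by
      ext a
      exact hφ W.unop V.unop i.unop.le a }

@[simp] theorem ap_mkHom {A B : U.Sh} (φ : ∀ W, Sec A W →ₗ[U.Fn W] Sec B W) (hφ) (W) (a) : ap (mkHom φ hφ) W a = φ W a := rfl

theorem push_smul {V : Man} (h : U ⟶ V) (A : U.Sh) (W) (f : V.Fn W) (a : Sec A ((Opens.map h.toTop).obj W)) : (f • (show Sec ((push h).obj A) W from a) : Sec ((push h).obj A) W) = fpull h W f • a := rfl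
theorem push_res {V : Man} (h : U ⟶ V) (A : U.Sh) {W X} (i : W ≤ X) (a : Sec A ((Opens.map h.toTop).obj X)) : res ((push h).obj A) i a = res A ((Opens.map h.toTop).monotone i) a := rfl
theorem push_ap {V : Man} (h : U ⟶ V) {A B : U.Sh} (κ : A ⟶ B) {W} (a : Sec A ((Opens.map h.toTop).obj W)) : ap ((push h).map κ) W a = ap κ _ a := rfl

/-- Bilinear maps of sheaves of modules. -/
@[ext] structure Bil (A B C : U.Sh) where
  toFun : ∀ W, Sec A W →ₗ[U.Fn W] Sec B W →ₗ[U.Fn W] Sec C W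
  res' : ∀ {V W} (h : V ≤ W) a b, toFun V (res A h a) (res B h b) = res C h (toFun W a b)

/-- The underlying presheaf of modules over the presheaf of commutative rings. -/
def psh (A : U.Sh) : PresheafOfModules.{0} (U.smoothPresheaf ⋙ forget₂ CommRingCat RingCat) := A.val

open MonoidalCategory in
/-- The tensor product of presheaves of modules, `W ↦ A(W) ⊗ B(W)`. -/
def ptensor (A B : U.Sh) : PresheafOfModules.{0} U.O.obj := (psh A ⊗ psh B :)

/-- The relative tensor product of sheaves of modules: the sheafification of `W ↦ A(W) ⊗ B(W)`. -/
def tensor (A B : U.Sh) : U.Sh := (PresheafOfModules.sheafification (𝟙 U.O.obj)).obj (ptensor A B)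

/-- The canonical morphism to the sheafification. -/
def toTensor (A B : U.Sh) : ptensor A B ⟶ (tensor A B).val :=
  PresheafOfModules.sheafificationHomEquiv (𝟙 U.O.obj) (𝟙 (tensor A B))

/-- The pure tensor `a ⊗ b` as a section of the tensor product sheaf. -/
def tmul {A B : U.Sh} {W} (a : Sec A W) (b : Sec B W) : Sec (tensor A B) W :=
  ((toTensor A B).app (op W)).hom (TensorProduct.tmul (U.Fn W) (M := Sec A W) (N := Sec B W) a b)

theorem tmul_def {A B : U.Sh} {W} (a : Sec A W) (b : Sec B W) : tmul a b = ((toTensor A B).app (op W)).hom (TensorProduct.tmul (U.Fn W) (M := Sec A W) (N := Sec B W) a b) := rfl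

theorem add_tmul {A B : U.Sh} {W} (a a' : Sec A W) (b : Sec B W) : tmul (a + a') b = tmul a b + tmul a' b := by
  unfold tmul
  rw [TensorProduct.add_tmul]
  exact map_add ((toTensor A B).app (op W)).hom _ _

theorem tmul_add {A B : U.Sh} {W} (a : Sec A W) (b b' : Sec B W) : tmul a (b + b') = tmul a b + tmul a b' := by
  unfold tmul
  rw [TensorProduct.tmul_add]
  exact map_add ((toTensor A B).app (op W)).hom _ _

theorem smul_tmul {A B : U.Sh} {W} (f : U.Fn W) (a : Sec A W) (b : Sec B W) : tmul (f • a) b = f • tmul a b := by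
  unfold tmul
  rw [← TensorProduct.smul_tmul']
  exact map_smul ((toTensor A B).app (op W)).hom _ _

theorem tmul_smul {A B : U.Sh} {W} (f : U.Fn W) (a : Sec A W) (b : Sec B W) : tmul a (f • b) = f • tmul a b := by
  unfold tmul
  rw [TensorProduct.tmul_smul]
  exact map_smul ((toTensor A B).app (op W)).hom _ _

theorem res_tmul {A B : U.Sh} {V W} (h : V ≤ W) (a : Sec A W) (b : Sec B W) : res (tensor A B) h (tmul a b) = tmul (res A h a) (res B h b) :=
  (PresheafOfModules.naturality_apply (toTensor A B) (homOfLE h).op (TensorProduct.tmul (U.Fn W) (M := Sec A W) (N := Sec B W) a b)).symm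

/-- The morphism of presheaves out of the tensor product given by a bilinear map. -/
def Bil.mk₀ {A B C : U.Sh} (β : Bil A B C) : ptensor A B ⟶ C.val where
  app W := ModuleCat.ofHom (X := (ptensor A B).obj W) (TensorProduct.lift (β.toFun W.unop))
  naturality {V W} i := by
    apply ModuleCat.MonoidalCategory.tensor_ext (R := U.smoothPresheaf.obj V) (M₁ := (psh A).obj V) (M₂ := (psh B).obj V)
    intro a b
    exact β.res' i.unop.le a b

/-- The morphism out of the tensor product given by a bilinear map. -/
def lift {A B C : U.Sh} (β : Bil A B C) : tensor A B ⟶ C :=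
  (PresheafOfModules.sheafificationHomEquiv (𝟙 U.O.obj)).symm β.mk₀

/-- Precomposition with the canonical morphism to the sheafification. -/
def toPre {A B C : U.Sh} (κ : tensor A B ⟶ C) : ptensor A B ⟶ C.val :=
  (PresheafOfModules.sheafificationHomEquiv (𝟙 U.O.obj)) κ

theorem toPre_app {A B C : U.Sh} (κ : tensor A B ⟶ C) (W) (a : Sec A W) (b : Sec B W) :
    ((toPre κ).app (op W)).hom (TensorProduct.tmul (U.Fn W) (M := Sec A W) (N := Sec B W) a b) = ap κ W (tmul a b) := by
  rfl

@[simp] theorem lift_tmul {A B C : U.Sh} (β : Bil A B C) (W) (a : Sec A W) (b : Sec B W) : ap (lift β) W (tmul a b) = β.toFun W a b := by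
  rw [← toPre_app]
  have : toPre (lift β) = β.mk₀ := (PresheafOfModules.sheafificationHomEquiv (𝟙 U.O.obj)).apply_symm_apply _
  rw [this]
  rfl

theorem tensor_ext {A B C : U.Sh} {κ τ : tensor A B ⟶ C} (h : ∀ W a b, ap κ W (tmul a b) = ap τ W (tmul a b)) : κ = τ := by
  apply (PresheafOfModules.sheafificationHomEquiv (𝟙 U.O.obj)).injective
  change toPre κ = toPre τ
  ext1 W
  apply ModuleCat.MonoidalCategory.tensor_ext (R := U.smoothPresheaf.obj W) (M₁ := (psh A).obj W) (M₂ := (psh B).obj W)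
  intro a b
  exact h W.unop a b

/-- The functor `V ↦ V ⊓ W`. -/
def infF (W : Opens U.toTop) : Opens U.toTop ⥤ Opens U.toTop :=
  Monotone.functor (f := fun V => V ⊓ W) (fun _ _ h => inf_le_inf_right _ h)

instance (W : Opens U.toTop) : (infF W).IsContinuous (Opens.grothendieckTopology U.toTop)
    (Opens.grothendieckTopology U.toTop) := by
  refine Functor.isContinuous_of_coverPreserving ?_ ?_
  · constructor
    intro F Z T x hx Y1 Y2 X f1 f2 g1 g2 h1 h2 e
    have k : X ⟶ (infF W).obj (Y1 ⊓ Y2) := homOfLE (le_inf (le_inf (f1.le.trans inf_le_left)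
      (f2.le.trans inf_le_left)) (f1.le.trans inf_le_right))
    have := congrArg (F.obj.map k.op) (hx (homOfLE (inf_le_left : Y1 ⊓ Y2 ≤ Y1)) (homOfLE inf_le_right) h1 h2 (Subsingleton.elim _ _))
    erw [← Functor.map_comp_apply, ← Functor.map_comp_apply] at this
    exact this
  · constructor
    intro V S hS x hx
    obtain ⟨V', f, hf, hV'⟩ := hS x hx.1
    exact ⟨V' ⊓ W, (infF W).map f, ⟨V', f, 𝟙 _, hf, rfl⟩, hV', hx.2⟩

/-- Restriction of functions, as a morphism of sheaves of rings. -/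
def resO (W : Opens U.toTop) : U.O ⟶ ((infF W).sheafPushforwardContinuous RingCat.{0} (Opens.grothendieckTopology U.toTop) (Opens.grothendieckTopology U.toTop)).obj U.O where
  hom :=
  { app := fun V => U.O.obj.map (homOfLE (inf_le_left : V.unop ⊓ W ≤ V.unop)).op
    naturality := fun V V' i =>
      (U.O.obj.map_comp i (homOfLE (inf_le_left : V'.unop ⊓ W ≤ V'.unop)).op).symm.trans
        (U.O.obj.map_comp (homOfLE (inf_le_left : V.unop ⊓ W ≤ V.unop)).op ((infF W).op.map i)) }

/-- The sheaf of modules `V ↦ C(V ⊓ W)`. -/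
def ext0 (W : Opens U.toTop) (C : U.Sh) : U.Sh := (SheafOfModules.pushforward (F := infF W) (resO W)).obj C

theorem ext0_res (W : Opens U.toTop) (C : U.Sh) {V V'} (h : V ≤ V') (a : Sec C (V' ⊓ W)) : res (ext0 W C) h a = res C (inf_le_inf_right W h) a := rfl
theorem ext0_smul (W : Opens U.toTop) (C : U.Sh) {V} (f : U.Fn V) (a : Sec C (V ⊓ W)) : (f • (show Sec (ext0 W C) V from a) : Sec (ext0 W C) V) = (show Sec C (V ⊓ W) from fres (inf_le_left : V ⊓ W ≤ V) f • a) := rfl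

section
variable {V : Man} (h : U ⟶ V)

/-- The preimage of an open subset. -/
abbrev pre (W : Opens V.toTop) : Opens U.toTop := (Opens.map h.toTop).obj W

/-- The canonical map `A(W) → (h^* A)(h⁻¹ W)`, `a ↦ a ⊗ 1`: the unit of the adjunction. -/
def toPull (A : V.Sh) {W} : Sec A W →+ Sec ((pull h).obj A) (pre h W) := (ap ((pullPushAdj h).unit.app A) W).toAddMonoidHom

theorem u_res (A : V.Sh) {W W'} (i : W ≤ W') (a : Sec A W') : toPull h A (res A i a) = res _ ((Opens.map h.toTop).monotone i) (toPull h A a) :=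
  ap_res ((pullPushAdj h).unit.app A) i a

theorem u_smul (A : V.Sh) {W} (f : V.Fn W) (a : Sec A W) : toPull h A (f • a) = fpull h W f • toPull h A a :=
  (ap ((pullPushAdj h).unit.app A) W).map_smul f a

theorem u_nat {A B : V.Sh} (κ : A ⟶ B) {W} (a : Sec A W) : toPull h B (ap κ W a) = ap ((pull h).map κ) _ (toPull h A a) :=
  congrArg (fun τ => ap τ W a) ((pullPushAdj h).unit.naturality κ)

/-- The morphism out of the inverse image that corresponds to a morphism to the direct image. -/
def desc {A : V.Sh} {C : U.Sh} (κ : A ⟶ (push h).obj C) : (pull h).obj A ⟶ C := ((pullPushAdj h).homEquiv A C).symm κ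

@[simp] theorem desc_u {A : V.Sh} {C : U.Sh} (κ : A ⟶ (push h).obj C) {W} (a : Sec A W) : ap (desc h κ) _ (toPull h A a) = ap κ W a := by
  have : ((pullPushAdj h).homEquiv A C) (desc h κ) = κ := Equiv.apply_symm_apply _ _
  conv_rhs => rw [← this, Adjunction.homEquiv_unit]
  rfl

theorem pull_ext {A : V.Sh} {C : U.Sh} {κ τ : (pull h).obj A ⟶ C} (H : ∀ W (a : Sec A W), ap κ _ (toPull h A a) = ap τ _ (toPull h A a)) : κ = τ := by
  apply ((pullPushAdj h).homEquiv A C).injective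
  rw [Adjunction.homEquiv_unit, Adjunction.homEquiv_unit]
  ext W a
  exact H W a

end

theorem ap_add {A B : U.Sh} (κ τ : A ⟶ B) (W) (a : Sec A W) : ap (κ + τ) W a = ap κ W a + ap τ W a := rfl
theorem fres_fres {V W X : Opens U.toTop} (h : V ≤ W) (k : W ≤ X) (f : U.Fn X) : fres h (fres k f) = fres (h.trans k) f := rfl
theorem fres_fpull {V : Man} (h : U ⟶ V) {W X : Opens V.toTop} (i : W ≤ X) (f : V.Fn X) : fpull h W (fres i f) = fres ((Opens.map h.toTop).monotone i) (fpull h X f) := rfl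

section ext0
variable {A B C : U.Sh} {W : Opens U.toTop}

/-- A morphism to `ext0 W C` evaluated on sections. -/
def apx (κ : A ⟶ ext0 W C) (V) : Sec A V →+ Sec C (V ⊓ W) := (ap κ V).toAddMonoidHom
theorem apx_smul (κ : A ⟶ ext0 W C) (V) (f : U.Fn V) (a : Sec A V) : apx κ V (f • a) = fres (inf_le_left : V ⊓ W ≤ V) f • apx κ V a := (ap κ V).map_smul f a
theorem apx_res (κ : A ⟶ ext0 W C) {V V'} (i : V ≤ V') (a : Sec A V') : apx κ V (res A i a) = res C (inf_le_inf_right W i) (apx κ V' a) := ap_res κ i a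
theorem apx_add (κ τ : A ⟶ ext0 W C) (V) (a : Sec A V) : apx (κ + τ) V a = apx κ V a + apx τ V a := rfl
theorem extHom_ext {κ τ : A ⟶ ext0 W C} (h : ∀ V a, apx κ V a = apx τ V a) : κ = τ := hom_ext h

/-- A morphism to `ext0 W C` from its action on sections. -/
def mkExt (φ : ∀ V, Sec A V → Sec C (V ⊓ W)) (add : ∀ V a b, φ V (a + b) = φ V a + φ V b)
    (smul : ∀ V (f : U.Fn V) a, φ V (f • a) = fres (inf_le_left : V ⊓ W ≤ V) f • φ V a)
    (hres : ∀ V V' (i : V ≤ V') a, φ V (res A i a) = res C (inf_le_inf_right W i) (φ V' a)) : A ⟶ ext0 W C :=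
  mkHom (fun V => { toFun := φ V, map_add' := add V, map_smul' := smul V }) hres

theorem apx_mkExt (φ : ∀ V, Sec A V → Sec C (V ⊓ W)) (add smul hres) (V) (a : Sec A V) : apx (mkExt φ add smul hres) V a = φ V a := rfl

/-- Multiplication by a function on `W`. -/
def fsmul (f : U.Fn W) (κ : A ⟶ ext0 W C) : A ⟶ ext0 W C :=
  mkExt (fun V a => fres (inf_le_right : V ⊓ W ≤ W) f • apx κ V a)
    (fun V a b => by rw [map_add, smul_add])
    (fun V g a => by rw [apx_smul, smul_comm])
    (fun V V' i a => by rw [apx_res, res_smul, fres_fres])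

theorem apx_fsmul (f : U.Fn W) (κ : A ⟶ ext0 W C) (V) (a : Sec A V) : apx (fsmul f κ) V a = fres (inf_le_right : V ⊓ W ≤ W) f • apx κ V a := rfl

/-- Restriction from `W` to `W'`. -/
def extRes {W' : Opens U.toTop} (i : W' ≤ W) (κ : A ⟶ ext0 W C) : A ⟶ ext0 W' C :=
  mkExt (fun V a => res C (inf_le_inf_left V i) (apx κ V a))
    (fun V a b => by rw [map_add, map_add])
    (fun V g a => by rw [apx_smul, res_smul, fres_fres])
    (fun V V' i a => by rw [apx_res, res_res, res_res])

theorem apx_extRes {W' : Opens U.toTop} (i : W' ≤ W) (κ : A ⟶ ext0 W C) {V} (a : Sec A V) : apx (extRes i κ) V a = res C (inf_le_inf_left V i) (apx κ V a) := rfl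

/-- A bilinear map with its first argument fixed. -/
def Bil.at (β : Bil A B C) (a : Sec A W) : B ⟶ ext0 W C :=
  mkExt (fun V b => β.toFun (V ⊓ W) (res A inf_le_right a) (res B inf_le_left b))
    (fun V b b' => by rw [map_add, map_add])
    (fun V g b => by rw [res_smul, map_smul])
    (fun V V' i b => by rw [← β.res', res_res, res_res, res_res])

theorem apx_at (β : Bil A B C) (a : Sec A W) (V) (b : Sec B V) : apx (β.at a) V b = β.toFun (V ⊓ W) (res A inf_le_right a) (res B inf_le_left b) := rfl

/-- Exchange of the arguments. -/
def Bil.flip (β : Bil A B C) : Bil B A C where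
  toFun W := (β.toFun W).flip
  res' h a b := β.res' h b a

theorem Bil.ext_at {β γ : Bil A B C} (h : ∀ W (a : Sec A W), β.at a = γ.at a) : β = γ := by
  ext W a b
  have := congrArg (fun κ => res C (le_inf le_rfl le_rfl) (apx κ W b)) (h W a)
  simp only [apx_at, ← β.res', ← γ.res'] at this
  simpa only [res_res, res_self] using this

/-- Trilinear maps of sheaves of modules. -/
@[ext] structure Tri (A B C D : U.Sh) where
  toFun : ∀ W, Sec A W → Sec B W → Sec C W → Sec D W
  res' : ∀ {V W} (h : V ≤ W) a b c, toFun V (res A h a) (res B h b) (res C h c) = res D h (toFun W a b c)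
  add₁ : ∀ W a a' b c, toFun W (a + a') b c = toFun W a b c + toFun W a' b c
  add₂ : ∀ W a b b' c, toFun W a (b + b') c = toFun W a b c + toFun W a b' c
  add₃ : ∀ W a b c c', toFun W a b (c + c') = toFun W a b c + toFun W a b c'
  smul₁ : ∀ W (f : U.Fn W) a b c, toFun W (f • a) b c = f • toFun W a b c
  smul₂ : ∀ W (f : U.Fn W) a b c, toFun W a (f • b) c = f • toFun W a b c
  smul₃ : ∀ W (f : U.Fn W) a b c, toFun W a b (f • c) = f • toFun W a b c

end ext0

section
variable {V : Man} (h : U ⟶ V) {A B : V.Sh} {C : U.Sh}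

/-- A morphism to a direct image from its action on sections. -/
def mkPush (φ : ∀ X, Sec A X → Sec C (pre h X)) (add : ∀ X a b, φ X (a + b) = φ X a + φ X b)
    (smul : ∀ X (f : V.Fn X) a, φ X (f • a) = fpull h X f • φ X a)
    (hres : ∀ X X' (i : X ≤ X') a, φ X (res A i a) = res C ((Opens.map h.toTop).monotone i) (φ X' a)) :
    A ⟶ (push h).obj C :=
  mkHom (fun V => { toFun := φ V, map_add' := add V, map_smul' := smul V }) hres

/-- A morphism out of an inverse image from its values on the sections `toPull h A a`. -/
def mkPull (φ : ∀ X, Sec A X → Sec C (pre h X)) (add : ∀ X a b, φ X (a + b) = φ X a + φ X b)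
    (smul : ∀ X (f : V.Fn X) a, φ X (f • a) = fpull h X f • φ X a)
    (hres : ∀ X X' (i : X ≤ X') a, φ X (res A i a) = res C ((Opens.map h.toTop).monotone i) (φ X' a)) :
    (pull h).obj A ⟶ C := desc h (mkPush h φ add smul hres)

theorem mkPull_u (φ : ∀ X, Sec A X → Sec C (pre h X)) (add smul hres) (X) (a : Sec A X) :
    ap (mkPull h φ add smul hres) (pre h X) (toPull h A a) = φ X a := desc_u h _ a

variable {W : Opens U.toTop}
/-- Variant of `mkPull` for morphisms to `ext0 W C`. -/
def mkPullx (φ : ∀ X, Sec A X → Sec C (pre h X ⊓ W)) (add : ∀ X a b, φ X (a + b) = φ X a + φ X b)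
    (smul : ∀ X (f : V.Fn X) a, φ X (f • a) = fres (inf_le_left : pre h X ⊓ W ≤ _) (fpull h X f) • φ X a)
    (hres : ∀ X X' (i : X ≤ X') a, φ X (res A i a) = res C (inf_le_inf_right W ((Opens.map h.toTop).monotone i)) (φ X' a)) :
    (pull h).obj A ⟶ ext0 W C := mkPull h φ add smul hres

theorem mkPullx_u (φ : ∀ X, Sec A X → Sec C (pre h X ⊓ W)) (add smul hres) (X) (a : Sec A X) :
    apx (mkPullx h φ add smul hres) (pre h X) (toPull h A a) = φ X a := mkPull_u h (C := ext0 W C) φ add smul hres X a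

theorem pull_extx {κ τ : (pull h).obj A ⟶ ext0 W C} (H : ∀ X (a : Sec A X), apx κ _ (toPull h A a) = apx τ _ (toPull h A a)) : κ = τ :=
  pull_ext h H

theorem pull_bil_ext {β γ : Bil ((pull h).obj A) ((pull h).obj B) C} (H : ∀ X (a : Sec A X) (b : Sec B X), β.toFun _ (toPull h A a) (toPull h B b) = γ.toFun _ (toPull h A a) (toPull h B b)) : β = γ := by
  have key : ∀ X (b : Sec B X), β.flip.at (toPull h B b) = γ.flip.at (toPull h B b) := by
    intro X b
    apply pull_extx h
    intro Y a
    simp only [apx_at]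
    have := H (Y ⊓ X) (res A inf_le_left a) (res B inf_le_right b)
    simp only [u_res] at this
    exact this
  apply Bil.ext_at
  intro W a
  apply pull_extx h
  intro X b
  have := congrArg (fun κ => res C (le_of_eq (inf_comm _ _)) (apx κ W a)) (key X b)
  simpa only [apx_at, ← Bil.res', res_res, Bil.flip, LinearMap.flip_apply] using this

end

section
variable {A B C D : U.Sh} {W : Opens U.toTop}

/-- A trilinear map with its last two arguments fixed. -/
def Tri.at (τ : Tri A B C D) (b : Sec B W) (c : Sec C W) : A ⟶ ext0 W D :=
  mkExt (fun V a => τ.toFun (V ⊓ W) (res A inf_le_left a) (res B inf_le_right b) (res C inf_le_right c))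
    (fun V b b' => by rw [map_add, τ.add₁])
    (fun V g b => by rw [res_smul, τ.smul₁])
    (fun V V' i b => by simp only [← τ.res', res_res])

theorem Tri.apx_at (τ : Tri A B C D) (b : Sec B W) (c : Sec C W) (V) (a : Sec A V) :
    apx (τ.at b c) V a = τ.toFun (V ⊓ W) (res A inf_le_left a) (res B inf_le_right b) (res C inf_le_right c) := rfl

/-- Cyclic permutation of the arguments. -/
def Tri.rot (τ : Tri A B C D) : Tri B C A D where
  toFun W b c a := τ.toFun W a b c
  res' h _ _ _ := τ.res' h _ _ _
  add₁ _ _ _ _ _ := τ.add₂ _ _ _ _ _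
  add₂ _ _ _ _ _ := τ.add₃ _ _ _ _ _
  add₃ _ _ _ _ _ := τ.add₁ _ _ _ _ _
  smul₁ _ _ _ _ _ := τ.smul₂ _ _ _ _ _
  smul₂ _ _ _ _ _ := τ.smul₃ _ _ _ _ _
  smul₃ _ _ _ _ _ := τ.smul₁ _ _ _ _ _

theorem Tri.eq_of_at {τ σ : Tri A B C D} {X Y : Opens U.toTop} (k : X ≤ Y) (a : Sec A X) (b : Sec B Y) (c : Sec C Y)
    (h : τ.at b c = σ.at b c) :
    τ.toFun X a (res B k b) (res C k c) = σ.toFun X a (res B k b) (res C k c) := by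
  have := congrArg (fun κ => res D (le_inf le_rfl k) (apx κ X a)) h
  simpa only [apx_at, ← τ.res', ← σ.res', res_res, res_self] using this

end

section
variable {V : Man} (h : U ⟶ V) {A B C : V.Sh} {D : U.Sh}

theorem pull_tri_ext_aux {B C : U.Sh} {τ σ : Tri ((pull h).obj A) B C D} (W : Opens U.toTop) (b : Sec B W) (c : Sec C W)
    (H : ∀ X (a : Sec A X) Y (i : Y ≤ pre h X) (j : Y ≤ W),
      τ.toFun Y (res _ i (toPull h A a)) (res B j b) (res C j c) = σ.toFun Y (res _ i (toPull h A a)) (res B j b) (res C j c)) :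
    ∀ Y (a : Sec ((pull h).obj A) Y) (j : Y ≤ W), τ.toFun Y a (res B j b) (res C j c) = σ.toFun Y a (res B j b) (res C j c) := by
  intro Y a j
  apply Tri.eq_of_at
  apply pull_extx
  intro X a
  exact H _ _ _ _ _

theorem pull_tri_ext {τ σ : Tri ((pull h).obj A) ((pull h).obj B) ((pull h).obj C) D}
    (H : ∀ X (a : Sec A X) (b : Sec B X) (c : Sec C X), τ.toFun _ (toPull h A a) (toPull h B b) (toPull h C c) = σ.toFun _ (toPull h A a) (toPull h B b) (toPull h C c)) : τ = σ := by
  have H' : ∀ W X (i : W ≤ pre h X) (a : Sec A X) Y (j : W ≤ pre h Y) (b : Sec B Y) Z (k : W ≤ pre h Z) (c : Sec C Z),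
      τ.toFun _ (res _ i (toPull h A a)) (res _ j (toPull h B b)) (res _ k (toPull h C c)) = σ.toFun _ (res _ i (toPull h A a)) (res _ j (toPull h B b)) (res _ k (toPull h C c)) := by
    intro W X i a Y j b Z k c
    have := congrArg (res D (show W ≤ pre h (X ⊓ Y ⊓ Z) from le_inf (le_inf i j) k)) (H (X ⊓ Y ⊓ Z) (res _ (inf_le_left.trans inf_le_left) a) (res _ (inf_le_left.trans inf_le_right) b) (res _ inf_le_right c))
    simpa only [u_res, ← τ.res', ← σ.res', res_res] using this
  have H1 : ∀ W (a : Sec ((pull h).obj A) W) Y (j : W ≤ pre h Y) (b : Sec B Y) Z (k : W ≤ pre h Z) (c : Sec C Z),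
      τ.toFun _ a (res _ j (toPull h B b)) (res _ k (toPull h C c)) = σ.toFun _ a (res _ j (toPull h B b)) (res _ k (toPull h C c)) := by
    intro W a Y j b Z k c
    have := pull_tri_ext_aux h (τ := τ) (σ := σ) W (res _ j (toPull h B b)) (res _ k (toPull h C c)) (fun X a' Y' i' j' => by
      simp only [res_res]; exact H' _ _ _ _ _ _ _ _ _ _) W a le_rfl
    simpa only [res_self] using this
  have H2 : ∀ W (a : Sec ((pull h).obj A) W) (b : Sec ((pull h).obj B) W) Z (k : W ≤ pre h Z) (c : Sec C Z),
      τ.toFun _ a b (res _ k (toPull h C c)) = σ.toFun _ a b (res _ k (toPull h C c)) := by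
    intro W a b Z k c
    have := pull_tri_ext_aux h (τ := τ.rot) (σ := σ.rot) W (res _ k (toPull h C c)) a (fun X a' Y' i' j' => by
      simp only [res_res]; exact H1 _ _ _ _ _ _ _ _) W b le_rfl
    simp only [res_self] at this
    exact this
  ext W a b c
  have := pull_tri_ext_aux h (τ := τ.rot.rot) (σ := σ.rot.rot) W a b (fun X a' Y' i' j' => by
      exact H2 _ _ _ _ _ _) W c le_rfl
  simp only [res_self] at this
  exact this

end

section
variable {V : Man} (h : U ⟶ V) {A B : V.Sh} {C : U.Sh}

/-- Bilinear maps along a morphism of manifolds. -/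
@[ext] structure BilOver (A B : V.Sh) (C : U.Sh) where
  toFun : ∀ X, Sec A X → Sec B X → Sec C (pre h X)
  res' : ∀ {X Y} (i : X ≤ Y) a b, toFun X (res A i a) (res B i b) = res C ((Opens.map h.toTop).monotone i) (toFun Y a b)
  add₁ : ∀ X a a' b, toFun X (a + a') b = toFun X a b + toFun X a' b
  add₂ : ∀ X a b b', toFun X a (b + b') = toFun X a b + toFun X a b'
  smul₁ : ∀ X (f : V.Fn X) a b, toFun X (f • a) b = fpull h X f • toFun X a b
  smul₂ : ∀ X (f : V.Fn X) a b, toFun X a (f • b) = fpull h X f • toFun X a b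

namespace BilOver
variable {h} (β : BilOver h A B C)

/-- First extension step. -/
def left {X} (a : Sec A X) : (pull h).obj B ⟶ ext0 (pre h X) C :=
  mkPullx h (fun Y b => res C (show pre h Y ⊓ pre h X ≤ pre h (Y ⊓ X) from le_rfl) (β.toFun (Y ⊓ X) (res A inf_le_right a) (res B inf_le_left b)))
    (fun Y b b' => by rw [map_add, β.add₂, map_add])
    (fun Y f b => by rw [res_smul, β.smul₂, res_smul, fres_fpull, fres_fres])
    (fun Y Y' i b => by
      have := β.res' (inf_le_inf_right X i) (res A inf_le_right a) (res B inf_le_left b)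
      simp only [res_res] at this ⊢
      rw [this, res_res])

theorem left_u {X} (a : Sec A X) {Y} (b : Sec B Y) : apx (β.left a) (pre h Y) (toPull h B b) =
    res C (show pre h Y ⊓ pre h X ≤ pre h (Y ⊓ X) from le_rfl) (β.toFun (Y ⊓ X) (res A inf_le_right a) (res B inf_le_left b)) := mkPullx_u ..

theorem left_add {X} (a a' : Sec A X) : β.left (a + a') = β.left a + β.left a' := by
  apply pull_extx h
  intro Y b
  rw [apx_add]
  simp only [left_u, map_add, β.add₁]

theorem left_smul {X} (f : V.Fn X) (a : Sec A X) : β.left (f • a) = fsmul (fpull h X f) (β.left a) := by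
  apply pull_extx h
  intro Y b
  rw [apx_fsmul]
  simp only [left_u, res_smul, β.smul₁, fres_fpull, fres_fres]

theorem left_res {X Y} (i : X ≤ Y) (a : Sec A Y) : β.left (res A i a) = extRes ((Opens.map h.toTop).monotone i) (β.left a) := by
  apply pull_extx h
  intro Z b
  rw [apx_extRes]
  simp only [left_u, res_res]
  have := β.res' (inf_le_inf_left Z i) (res A inf_le_right a) (res B inf_le_left b)
  simp only [res_res] at this ⊢
  rw [this, res_res]

/-- Second extension step. -/
def right {W : Opens U.toTop} (b : Sec ((pull h).obj B) W) : (pull h).obj A ⟶ ext0 W C :=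
  mkPullx h (fun X a => res C (le_of_eq (inf_comm _ _)) (apx (β.left a) W b))
    (fun X a a' => by rw [left_add, apx_add, map_add])
    (fun X f a => by rw [left_smul, apx_fsmul, res_smul, fres_fres])
    (fun X X' i a => by rw [left_res, apx_extRes, res_res, res_res])

theorem right_u {W : Opens U.toTop} (b : Sec ((pull h).obj B) W) {X} (a : Sec A X) :
    apx (β.right b) (pre h X) (toPull h A a) = res C (le_of_eq (inf_comm _ _)) (apx (β.left a) W b) := mkPullx_u ..

theorem right_add {W} (b b' : Sec ((pull h).obj B) W) : β.right (b + b') = β.right b + β.right b' := by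
  apply pull_extx h
  intro Y a
  rw [apx_add]
  simp only [right_u, map_add]

theorem right_smul {W} (f : U.Fn W) (b : Sec ((pull h).obj B) W) : β.right (f • b) = fsmul f (β.right b) := by
  apply pull_extx h
  intro Y a
  rw [apx_fsmul]
  simp only [right_u, apx_smul, res_smul, fres_fres]

theorem right_res {W W'} (i : W' ≤ W) (b : Sec ((pull h).obj B) W) : β.right (res _ i b) = extRes i (β.right b) := by
  apply pull_extx h
  intro Y a
  rw [apx_extRes]
  simp only [right_u, apx_res, res_res]

/-- The bilinear map of inverse images with `β(a ⊗ 1, b ⊗ 1) = β(a, b)`; as a morphism out of the tensor product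
it is the composite `h^* A ⊗ h^* B ≅ h^* (A ⊗ B) ⟶ C`. -/
def extend : Bil ((pull h).obj A) ((pull h).obj B) C where
  toFun W := LinearMap.mk₂ (U.Fn W) (fun a b => res C (le_inf le_rfl le_rfl) (apx (β.right b) W a))
    (fun a a' b => by rw [map_add, map_add])
    (fun f a b => by rw [apx_smul, res_smul, fres_fres]; congr 1)
    (fun a b b' => by rw [right_add, apx_add, map_add])
    (fun f a b => by rw [right_smul, apx_fsmul, res_smul, fres_fres]; congr 1)
  res' i a b := by
    simp only [LinearMap.mk₂_apply]
    rw [right_res, apx_extRes, apx_res, res_res, res_res, res_res]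

theorem extend_u {X} (a : Sec A X) (b : Sec B X) : β.extend.toFun _ (toPull h A a) (toPull h B b) = β.toFun X a b := by
  change res C (le_inf le_rfl le_rfl) (apx (β.right (toPull h B b)) _ (toPull h A a)) = _
  rw [right_u, left_u, res_res, res_res]
  have := congrArg (res C (show pre h X ≤ pre h (X ⊓ X) from le_inf le_rfl le_rfl)) (β.res' (inf_le_left : X ⊓ X ≤ X) a b)
  rw [res_res, res_self] at this
  exact this

end BilOver
end

/-- Complex conjugation of smooth functions, `f ↦ conj ∘ f`. -/
def conjFn (W : Opens U.carrier) : C^∞⟮𝓡 U.dim, W; 𝓘(ℝ, ℂ), ℂ⟯ →+* C^∞⟮𝓡 U.dim, W; 𝓘(ℝ, ℂ), ℂ⟯ :=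
  ContMDiffMap.compLeftRingHom (𝓡 U.dim) W (I' := 𝓘(ℝ, ℂ)) (I'' := 𝓘(ℝ, ℂ)) (n := ∞) (starRingEnd ℂ) Complex.conjCLE.contDiff.contMDiff

/-- Complex conjugation of smooth functions. -/
def fconj (W : Opens U.toTop) : U.Fn W →+* U.Fn W := conjFn W

theorem fconj_fconj {W : Opens U.toTop} (f : U.Fn W) : fconj W (fconj W f) = f := by
  refine ContMDiffMap.ext (f := fconj W (fconj W f)) (g := f) fun x => ?_
  exact Complex.conj_conj _

theorem fconj_res {W X : Opens U.toTop} (i : W ≤ X) (f : U.Fn X) : fconj W (fres i f) = fres i (fconj X f) := rfl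
theorem fconj_fpull {V : Man} (h : U ⟶ V) {X : Opens V.toTop} (f : V.Fn X) : fpull h X (fconj X f) = fconj _ (fpull h X f) := rfl

/-- Complex conjugation as an endomorphism of the sheaf of smooth functions. -/
def conjO (U : Man) : U.O ⟶ U.O where
  hom := { app := fun W => RingCat.ofHom (fconj W.unop), naturality := fun _ _ _ => rfl }

/-- The conjugate sheaf of modules: the same sections, with functions acting through their complex conjugates. -/
def conj (A : U.Sh) : U.Sh := (SheafOfModules.restrictScalars (conjO U)).obj A

section
variable {A B : U.Sh}
/-- A morphism to a conjugate sheaf of modules as a conjugate linear map on sections. -/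
def apc (κ : A ⟶ conj B) (W) : Sec A W →+ Sec B W := (ap κ W).toAddMonoidHom
theorem apc_smul (κ : A ⟶ conj B) (W) (f : U.Fn W) (a) : apc κ W (f • a) = fconj W f • apc κ W a := (ap κ W).map_smul f a
theorem apc_res (κ : A ⟶ conj B) {V W} (i : V ≤ W) (a) : apc κ V (res A i a) = res B i (apc κ W a) := ap_res κ i a
theorem conjHom_ext {κ τ : A ⟶ conj B} (H : ∀ W a, apc κ W a = apc τ W a) : κ = τ := hom_ext H
end

section
variable {V : Man} (h : U ⟶ V) {A : V.Sh} {C : U.Sh}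

/-- Variant of `mkPull` for conjugate linear maps. -/
def mkPullc (φ : ∀ X, Sec A X → Sec C (pre h X)) (add : ∀ X a b, φ X (a + b) = φ X a + φ X b)
    (smul : ∀ X (f : V.Fn X) a, φ X (f • a) = fconj _ (fpull h X f) • φ X a)
    (hres : ∀ X X' (i : X ≤ X') a, φ X (res A i a) = res C ((Opens.map h.toTop).monotone i) (φ X' a)) :
    (pull h).obj A ⟶ conj C := mkPull h φ add smul hres
theorem mkPullc_u (φ : ∀ X, Sec A X → Sec C (pre h X)) (add smul hres) (X) (a : Sec A X) :
    apc (mkPullc h φ add smul hres) (pre h X) (toPull h A a) = φ X a := mkPull_u h (C := conj C) φ add smul hres X a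
end

/-- The sheaf of smooth functions as a sheaf of modules over itself. -/
def unitSh (U : Man) : U.Sh := SheafOfModules.unit U.O

/-- A function as a section of `unitSh`. -/
def fnSec {W : Opens U.toTop} (f : U.Fn W) : Sec U.unitSh W := f

theorem unit_ext {A : U.Sh} {κ τ : U.unitSh ⟶ A} (H : ap κ ⊤ (fnSec 1) = ap τ ⊤ (fnSec 1)) : κ = τ := by
  ext W f
  have e : f = (show U.Fn W from f) • res U.unitSh le_top (fnSec 1) := by
    exact (mul_one (show U.Fn W from f)).symm
  rw [e, map_smul, map_smul, ap_res, ap_res, H]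

/-- The morphism `f ↦ f • s`. -/
def mkUnit {A : U.Sh} (s : Sec A ⊤) : U.unitSh ⟶ A :=
  mkHom (fun W => LinearMap.toSpanSingleton (U.Fn W) (Sec A W) (res A le_top s))
    (fun V W i f => by
      change (fres i (show U.Fn W from f)) • res A le_top s = res A i ((show U.Fn W from f) • res A le_top s)
      rw [res_smul, res_res])

theorem mkUnit_one {A : U.Sh} (s : Sec A ⊤) : ap (mkUnit s) ⊤ (fnSec 1) = s := by
  change (1 : U.Fn ⊤) • res A le_top s = s
  rw [one_smul, res_self]

/-- Order-reversing `*`-monoids in sheaves of modules over the smooth complex valued functions, i.e. associative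
unital `*`-algebras: a sheaf of modules `A` with a multiplication `A ⊗ A ⟶ A`, a unit `C^∞_U ⟶ A` and a
`*`-involution from `A` to its conjugate, all of them morphisms of sheaves of modules, with
`(ab)c = a(bc)`, `1a = a = a1`, `a** = a`, `1* = 1` and `(ab)* = b* a*`. -/
structure StarMonoid (U : Man) where
  carrier : U.Sh
  mul : tensor carrier carrier ⟶ carrier
  one : U.unitSh ⟶ carrier
  star : carrier ⟶ conj carrier
  mul_assoc : ∀ (W : Opens U.toTop) (a b c : Sec carrier W),
    ap mul W (tmul (ap mul W (tmul a b)) c) = ap mul W (tmul a (ap mul W (tmul b c)))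
  one_mul : ∀ (W : Opens U.toTop) (a : Sec carrier W), ap mul W (tmul (ap one W (fnSec 1)) a) = a
  mul_one : ∀ (W : Opens U.toTop) (a : Sec carrier W), ap mul W (tmul a (ap one W (fnSec 1))) = a
  star_star : ∀ (W : Opens U.toTop) (a : Sec carrier W), apc star W (apc star W a) = a
  star_one : ∀ (W : Opens U.toTop), apc star W (ap one W (fnSec 1)) = ap one W (fnSec 1)
  star_mul : ∀ (W : Opens U.toTop) (a b : Sec carrier W),
    apc star W (ap mul W (tmul a b)) = ap mul W (tmul (apc star W b) (apc star W a))

namespace StarMonoid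

/-- Morphisms of sheaves of modules that preserve multiplications, units and involutions. -/
@[ext] structure Hom (A B : StarMonoid U) where
  hom : A.carrier ⟶ B.carrier
  map_mul : ∀ (W : Opens U.toTop) (a b : Sec A.carrier W),
    ap hom W (ap A.mul W (tmul a b)) = ap B.mul W (tmul (ap hom W a) (ap hom W b))
  map_one : A.one ≫ hom = B.one
  map_star : ∀ (W : Opens U.toTop) (a : Sec A.carrier W), ap hom W (apc A.star W a) = apc B.star W (ap hom W a)

/-- The category of order-reversing `*`-monoids. -/
instance : Category (StarMonoid U) where
  Hom A B := Hom A B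
  id A := ⟨𝟙 _, fun _ _ _ => rfl, Category.comp_id _, fun _ _ => rfl⟩
  comp f g := ⟨f.hom ≫ g.hom, fun W a b => by simp only [ap_comp, f.map_mul, g.map_mul],
    by rw [← Category.assoc, f.map_one, g.map_one], fun W a => by simp only [ap_comp, f.map_star, g.map_star]⟩

@[simp] theorem comp_hom {A B C : StarMonoid U} (f : A ⟶ B) (g : B ⟶ C) : (f ≫ g).hom = f.hom ≫ g.hom := rfl
@[simp] theorem id_hom (A : StarMonoid U) : Hom.hom (𝟙 A) = 𝟙 A.carrier := rfl

@[ext] theorem hom_ext {A B : StarMonoid U} {f g : A ⟶ B} (H : f.hom = g.hom) : f = g := Hom.ext H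

/-- An isomorphism of sheaves of modules that preserves the structure is an isomorphism of `*`-monoids. -/
def mkIso {A B : StarMonoid U} (e : A.carrier ≅ B.carrier)
   (map_mul : ∀ (W : Opens U.toTop) (a b : Sec A.carrier W),
    ap e.hom W (ap A.mul W (tmul a b)) = ap B.mul W (tmul (ap e.hom W a) (ap e.hom W b)))
   (map_one : A.one ≫ e.hom = B.one)
   (map_star : ∀ (W : Opens U.toTop) (a : Sec A.carrier W), ap e.hom W (apc A.star W a) = apc B.star W (ap e.hom W a)) : A ≅ B where
  hom := ⟨e.hom, map_mul, map_one, map_star⟩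
  inv := ⟨e.inv, fun W a b => by
      have h1 : ∀ b, ap e.inv W (ap e.hom W b) = b := fun b => by rw [← ap_comp, e.hom_inv_id, ap_id]
      have h2 : ∀ b, ap e.hom W (ap e.inv W b) = b := fun b => by rw [← ap_comp, e.inv_hom_id, ap_id]
      conv_lhs => rw [← h2 a, ← h2 b, ← map_mul, h1],
    by rw [Iso.comp_inv_eq, map_one], fun W a => by
      have h1 : ∀ b, ap e.inv W (ap e.hom W b) = b := fun b => by rw [← ap_comp, e.hom_inv_id, ap_id]
      have h2 : ∀ b, ap e.hom W (ap e.inv W b) = b := fun b => by rw [← ap_comp, e.inv_hom_id, ap_id]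
      conv_lhs => rw [← h2 a, ← map_star, h1]⟩

section pull
variable {V : Man} (h : U ⟶ V)

/-- The multiplication of `h^* A`, with `(a ⊗ 1)(b ⊗ 1) = ab ⊗ 1`: it is the composite
`h^* A ⊗ h^* A ≅ h^* (A ⊗ A) ⟶ h^* A`. -/
def pullMul (A : StarMonoid V) : Bil ((pull h).obj A.carrier) ((pull h).obj A.carrier) ((pull h).obj A.carrier) :=
  BilOver.extend (h := h)
  { toFun := fun X a b => toPull h A.carrier (ap A.mul X (tmul a b))
    res' := fun i a b => by rw [← res_tmul, ap_res, u_res]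
    add₁ := fun X a a' b => by rw [add_tmul, map_add, map_add]
    add₂ := fun X a a' b => by rw [tmul_add, map_add, map_add]
    smul₁ := fun X f a b => by rw [smul_tmul, map_smul, u_smul]
    smul₂ := fun X f a b => by rw [tmul_smul, map_smul, u_smul] }

theorem pullMul_u (A : StarMonoid V) {X} (a b : Sec A.carrier X) : (pullMul h A).toFun _ (toPull h _ a) (toPull h _ b) = toPull h A.carrier (ap A.mul X (tmul a b)) := BilOver.extend_u _ a b

/-- The involution of `h^* A`, with `(a ⊗ 1)* = a* ⊗ 1`: it is the composite of `h^*` of the involution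
with the canonical isomorphism from `h^*` of the conjugate of `A` to the conjugate of `h^* A`. -/
def pullStar (A : StarMonoid V) : (pull h).obj A.carrier ⟶ conj ((pull h).obj A.carrier) :=
  mkPullc h (fun X a => toPull h A.carrier (apc A.star X a)) (fun X a b => by rw [map_add, map_add])
    (fun X f a => by rw [apc_smul, u_smul, fconj_fpull]) (fun X Y i a => by rw [apc_res, u_res])

theorem pullStar_u (A : StarMonoid V) {X} (a : Sec A.carrier X) : apc (pullStar h A) _ (toPull h _ a) = toPull h _ (apc A.star X a) := mkPullc_u ..

theorem le_pre_top : ⊤ ≤ pre h ⊤ := le_rfl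

/-- The unit of `h^* A`, `1 ⊗ 1`: it is the composite `C^∞_U ≅ h^* C^∞_V ⟶ h^* A`. -/
def pullOne (A : StarMonoid V) : U.unitSh ⟶ (pull h).obj A.carrier :=
  mkUnit (res _ (le_pre_top h) (toPull h A.carrier (ap A.one ⊤ (fnSec 1))))

theorem res_one {A : U.Sh} (κ : U.unitSh ⟶ A) (W : Opens U.toTop) : ap κ W (fnSec 1) = res A le_top (ap κ ⊤ (fnSec 1)) :=
  ap_res κ (le_top : W ≤ ⊤) (fnSec (1 : U.Fn ⊤))

theorem pullOne_one (A : StarMonoid V) (X : Opens V.toTop) : ap (pullOne h A) (pre h X) (fnSec 1) = toPull h A.carrier (ap A.one X (fnSec 1)) := by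
  rw [res_one, res_one A.one X, u_res, pullOne, mkUnit_one, res_res]

end pull
end StarMonoid

namespace StarMonoid

/-- The multiplication as a bilinear map. -/
def mulBil (A : StarMonoid U) : Bil A.carrier A.carrier A.carrier where
  toFun W := LinearMap.mk₂ (U.Fn W) (fun a b => ap A.mul W (tmul a b))
    (fun _ _ _ => by rw [add_tmul, map_add])
    (fun _ _ _ => by rw [smul_tmul, map_smul])
    (fun _ _ _ => by rw [tmul_add, map_add])
    (fun _ _ _ => by rw [tmul_smul, map_smul])
  res' _ _ _ := by simp only [LinearMap.mk₂_apply, ← res_tmul, ap_res]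

end StarMonoid

/-- Composition with a morphism. -/
def Bil.comp {A B C D : U.Sh} (β : Bil A B C) (κ : C ⟶ D) : Bil A B D where
  toFun W := (β.toFun W).compr₂ (ap κ W)
  res' _ _ _ := by simp only [LinearMap.compr₂_apply, β.res', ap_res]

/-- Precomposition with morphisms. -/
def Bil.compl {A B C A' B' : U.Sh} (β : Bil A B C) (κ : A' ⟶ A) (τ : B' ⟶ B) : Bil A' B' C where
  toFun W := (β.toFun W).compl₁₂ (ap κ W) (ap τ W)
  res' _ _ _ := by simp only [LinearMap.compl₁₂_apply, β.res', ap_res]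

/-- Functoriality of the conjugate sheaf of modules. -/
def conjMap {A B : U.Sh} (κ : A ⟶ B) : conj A ⟶ conj B := (SheafOfModules.restrictScalars (conjO U)).map κ

/-- The trilinear map `(ab)c`. -/
def Bil.triL {A : U.Sh} (β : Bil A A A) : Tri A A A A where
  toFun W a b c := β.toFun W (β.toFun W a b) c
  res' _ _ _ _ := by simp only [β.res']
  add₁ _ _ _ _ _ := by simp
  add₂ _ _ _ _ _ := by simp
  add₃ _ _ _ _ _ := by simp
  smul₁ _ _ _ _ _ := by simp
  smul₂ _ _ _ _ _ := by simp
  smul₃ _ _ _ _ _ := by simp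

/-- The trilinear map `a(bc)`. -/
def Bil.triR {A : U.Sh} (β : Bil A A A) : Tri A A A A where
  toFun W a b c := β.toFun W a (β.toFun W b c)
  res' _ _ _ _ := by simp only [β.res']
  add₁ _ _ _ _ _ := by simp
  add₂ _ _ _ _ _ := by simp
  add₃ _ _ _ _ _ := by simp
  smul₁ _ _ _ _ _ := by simp
  smul₂ _ _ _ _ _ := by simp
  smul₃ _ _ _ _ _ := by simp

/-- The morphism `b ↦ β(s, b)` for a global section `s`. -/
def Bil.leftTop {A B C : U.Sh} (β : Bil A B C) (s : Sec A ⊤) : B ⟶ C :=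
  mkHom (fun W => β.toFun W (res A le_top s)) (fun V W i b => by rw [← β.res', res_res])

/-- The bilinear map `(a, b) ↦ (b* a*)*`. -/
def Bil.starred {A : U.Sh} (β : Bil A A A) (σ : A ⟶ conj A) : Bil A A A where
  toFun W := LinearMap.mk₂ (U.Fn W) (fun a b => apc σ W (β.toFun W (apc σ W b) (apc σ W a)))
    (fun _ _ _ => by simp only [map_add])
    (fun _ _ _ => by simp only [apc_smul, map_smul, fconj_fconj])
    (fun _ _ _ => by simp only [map_add, LinearMap.add_apply])
    (fun _ _ _ => by simp only [apc_smul, map_smul, LinearMap.smul_apply, fconj_fconj])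
  res' _ _ _ := by simp only [LinearMap.mk₂_apply, apc_res, β.res']

/-- The morphism `a ↦ a**`. -/
def starSq {A : U.Sh} (σ : A ⟶ conj A) : A ⟶ A :=
  mkHom (fun W =>
    { toFun := fun a => apc σ W (apc σ W a)
      map_add' := fun _ _ => by simp only [map_add]
      map_smul' := fun _ _ => by simp only [apc_smul, fconj_fconj, RingHom.id_apply] })
    (fun V W i a => by simp only [LinearMap.coe_mk, AddHom.coe_mk, apc_res])

namespace StarMonoid
variable {V : Man} (h : U ⟶ V)

theorem pull_mul_assoc (A : StarMonoid V) : (pullMul h A).triL = (pullMul h A).triR := by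
  apply pull_tri_ext h
  intro X a b c
  simp only [Bil.triL, Bil.triR, pullMul_u, A.mul_assoc]

theorem pull_one_mul (A : StarMonoid V) : (pullMul h A).leftTop (ap (pullOne h A) ⊤ (fnSec 1)) = 𝟙 _ := by
  apply pull_ext h
  intro X a
  change (pullMul h A).toFun _ (res _ le_top (ap (pullOne h A) ⊤ (fnSec 1))) _ = _
  rw [← res_one, pullOne_one, pullMul_u, A.one_mul, ap_id]

theorem pull_mul_one (A : StarMonoid V) : (pullMul h A).flip.leftTop (ap (pullOne h A) ⊤ (fnSec 1)) = 𝟙 _ := by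
  apply pull_ext h
  intro X a
  change (pullMul h A).toFun _ _ (res _ le_top (ap (pullOne h A) ⊤ (fnSec 1))) = _
  rw [← res_one, pullOne_one, pullMul_u, A.mul_one, ap_id]

theorem pull_star_star (A : StarMonoid V) : starSq (pullStar h A) = 𝟙 _ := by
  apply pull_ext h
  intro X a
  change apc (pullStar h A) _ (apc (pullStar h A) _ (toPull h _ a)) = _
  rw [pullStar_u, pullStar_u, A.star_star, ap_id]

theorem pull_star_mul (A : StarMonoid V) : (pullMul h A).starred (pullStar h A) = pullMul h A := by
  apply pull_bil_ext h
  intro X a b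
  change apc (pullStar h A) _ ((pullMul h A).toFun _ (apc (pullStar h A) _ (toPull h _ b)) (apc (pullStar h A) _ (toPull h _ a))) = _
  rw [pullStar_u, pullStar_u, pullMul_u, pullStar_u, pullMul_u, A.star_mul, A.star_star, A.star_star]

/-- The inverse image of a `*`-monoid. -/
def pullObj (A : StarMonoid V) : StarMonoid U where
  carrier := (pull h).obj A.carrier
  mul := lift (pullMul h A)
  one := pullOne h A
  star := pullStar h A
  mul_assoc W a b c := by
    simp only [lift_tmul]
    exact congrArg (fun τ => τ.toFun W a b c) (pull_mul_assoc h A)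
  one_mul W a := by
    simp only [lift_tmul]
    rw [res_one]
    exact congrArg (fun τ => ap τ W a) (pull_one_mul h A)
  mul_one W a := by
    simp only [lift_tmul]
    rw [res_one]
    exact congrArg (fun τ => ap τ W a) (pull_mul_one h A)
  star_star W a := congrArg (fun τ => ap τ W a) (pull_star_star h A)
  star_one W := by
    rw [res_one, apc_res]
    congr 1
    have := pullStar_u h A (ap A.one ⊤ (fnSec 1))
    rw [A.star_one, ← pullOne_one] at this
    exact this
  star_mul W a b := by
    simp only [lift_tmul]
    have h1 := congrArg (fun τ => apc (pullStar h A) W (τ.toFun W a b)) (pull_star_mul h A)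
    have h2 := congrArg (fun τ => ap τ W ((pullMul h A).toFun W (apc (pullStar h A) W b) (apc (pullStar h A) W a))) (pull_star_star h A)
    exact h1.symm.trans h2

theorem pullObj_mul_u (A : StarMonoid V) {X} (a b : Sec A.carrier X) :
    ap (pullObj h A).mul _ (tmul (toPull h _ a) (toPull h _ b)) = toPull h _ (ap A.mul X (tmul a b)) := by
  rw [← pullMul_u]; exact lift_tmul _ _ _ _

/-- A morphism out of the pullback is a morphism of `*`-monoids as soon as it is one on the generators. -/
def homOfU {A : StarMonoid V} {B : StarMonoid U} (κ : (pull h).obj A.carrier ⟶ B.carrier)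
   (H1 : ∀ (X : Opens V.toTop) (a b : Sec A.carrier X), ap κ _ (toPull h _ (ap A.mul X (tmul a b))) = ap B.mul _ (tmul (ap κ _ (toPull h _ a)) (ap κ _ (toPull h _ b))))
   (H2 : ∀ (X : Opens V.toTop), ap κ _ (toPull h _ (ap A.one X (fnSec 1))) = ap B.one _ (fnSec 1))
   (H3 : ∀ (X : Opens V.toTop) (a : Sec A.carrier X), ap κ _ (toPull h _ (apc A.star X a)) = apc B.star _ (ap κ _ (toPull h _ a))) :
   pullObj h A ⟶ B where
  hom := κ
  map_mul W a b := by
    have key : (pullMul h A).comp κ = B.mulBil.compl κ κ := by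
      apply pull_bil_ext h
      intro X a b
      change ap κ _ ((pullMul h A).toFun _ _ _) = ap B.mul _ (tmul (ap κ _ _) (ap κ _ _))
      rw [pullMul_u, H1]
    have := congrArg (fun τ => τ.toFun W a b) key
    exact (congrArg (ap κ W) (lift_tmul (pullMul h A) W a b)).trans this
  map_one := by
    apply unit_ext
    have := H2 ⊤
    rw [← pullOne_one] at this
    exact this
  map_star W a := by
    have key : pullStar h A ≫ conjMap κ = κ ≫ B.star := by
      apply pull_ext h
      intro X a
      change ap κ _ (apc (pullStar h A) _ _) = apc B.star _ (ap κ _ _)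
      rw [pullStar_u, H3]
    exact congrArg (fun τ => ap τ W a) key

end StarMonoid

theorem pullId_u (A : U.Sh) {X} (a : Sec A X) : ap ((pullId U).hom.app A) X (toPull (𝟙 U) A a) = a := by
  have := unit_conjugateEquiv .id (pullPushAdj (𝟙 U)) (pullId U).hom A
  rw [conjugateEquiv_pullId] at this
  exact (congrArg (fun τ => ap τ X a) this).symm

theorem pullComp_u {V W : Man} (h : U ⟶ V) (g : V ⟶ W) (A : W.Sh) {X} (a : Sec A X) :
    ap ((pullComp h g).inv.app A) _ (toPull (h ≫ g) A a) = toPull h _ (toPull g A a) := by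
  have := unit_conjugateEquiv ((pullPushAdj g).comp (pullPushAdj h)) (pullPushAdj (h ≫ g)) (pullComp h g).inv A
  rw [conjugateEquiv_pullComp] at this
  exact (congrArg (fun τ => ap τ X a) this).symm

namespace StarMonoid

section
variable {V : Man} (h : U ⟶ V)

/-- The map `toPull`, with values in the underlying sheaf of `pullObj h A`. -/
def toPullObj (A : StarMonoid V) {X : Opens V.toTop} (a : Sec A.carrier X) : Sec (pullObj h A).carrier (pre h X) := toPull h A.carrier a

theorem uu_mul (A : StarMonoid V) {X} (a b : Sec A.carrier X) :
   toPullObj h A (ap A.mul X (tmul a b)) = ap (pullObj h A).mul _ (tmul (toPullObj h A a) (toPullObj h A b)) := (pullObj_mul_u h A a b).symm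
theorem uu_star (A : StarMonoid V) {X} (a : Sec A.carrier X) :
   toPullObj h A (apc A.star X a) = apc (pullObj h A).star _ (toPullObj h A a) := (pullStar_u h A a).symm
theorem uu_one (A : StarMonoid V) (X) :
   toPullObj h A (ap A.one X (fnSec 1)) = ap (pullObj h A).one _ (fnSec 1) := (pullOne_one h A X).symm

/-- Variant of `homOfU` with prescribed values on the sections `a ⊗ 1`. -/
def homOfUU {A : StarMonoid V} {B : StarMonoid U} (κ : (pull h).obj A.carrier ⟶ B.carrier)
   (φ : ∀ X, Sec A.carrier X → Sec B.carrier (pre h X))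
   (hφ : ∀ X a, ap κ (pre h X) (toPull h _ a) = φ X a)
   (H1 : ∀ (X : Opens V.toTop) (a b : Sec A.carrier X), φ X (ap A.mul X (tmul a b)) = ap B.mul _ (tmul (φ X a) (φ X b)))
   (H2 : ∀ (X : Opens V.toTop), φ X (ap A.one X (fnSec 1)) = ap B.one _ (fnSec 1))
   (H3 : ∀ (X : Opens V.toTop) (a : Sec A.carrier X), φ X (apc A.star X a) = apc B.star _ (φ X a)) :
   pullObj h A ⟶ B :=
  homOfU h κ (fun X a b => by rw [hφ, hφ, hφ, H1]) (fun X => by rw [hφ, H2]) (fun X a => by rw [hφ, hφ, H3])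

/-- Functoriality of the inverse image. -/
def pullMap {A B : StarMonoid V} (f : A ⟶ B) : pullObj h A ⟶ pullObj h B :=
  homOfUU h ((pull h).map f.hom) (fun X a => toPullObj h B (ap f.hom X a)) (fun X a => (u_nat h f.hom a).symm)
    (fun X a b => by rw [f.map_mul, uu_mul])
    (fun X => by rw [← uu_one, ← f.map_one, ap_comp])
    (fun X a => by rw [f.map_star, uu_star])

/-- The inverse image functor `h^*` for `*`-monoids. -/
def pullFunctor : StarMonoid V ⥤ StarMonoid U where
  obj := pullObj h
  map := pullMap h
  map_id A := by ext1; exact (pull h).map_id _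
  map_comp f g := by ext1; exact (pull h).map_comp _ _

end

/-- The coherence morphism for an identity. -/
def pullIdHom (A : StarMonoid U) : pullObj (𝟙 U) A ⟶ A :=
  homOfUU (𝟙 U) ((pullId U).hom.app A.carrier) (fun _ a => a) (fun _ a => pullId_u A.carrier a)
    (fun _ _ _ => rfl) (fun _ => rfl) (fun _ _ => rfl)

/-- The coherence isomorphism for an identity. -/
def pullIdIso (U : Man) : pullFunctor (𝟙 U) ≅ 𝟭 (StarMonoid U) :=
  NatIso.ofComponents (fun A =>
    mkIso (A := pullObj (𝟙 U) A) (B := A) ((pullId U).app A.carrier) (pullIdHom A).map_mul (pullIdHom A).map_one (pullIdHom A).map_star)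
    (fun f => by ext1; exact (pullId U).hom.naturality f.hom)

/-- The coherence morphism for a composition. -/
def pullCompHom {V W : Man} (h : U ⟶ V) (g : V ⟶ W) (A : StarMonoid W) : pullObj (h ≫ g) A ⟶ pullObj h (pullObj g A) :=
  homOfUU (h ≫ g) ((pullComp h g).inv.app A.carrier) (fun X a => toPullObj h (pullObj g A) (toPullObj g A a)) (fun X a => pullComp_u h g A.carrier a)
      (fun X a b => by rw [uu_mul, uu_mul]; rfl)
      (fun X => by rw [uu_one, uu_one]; rfl)
      (fun X a => by rw [uu_star, uu_star]; rfl)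

/-- The coherence isomorphism for a composition. -/
def pullCompIso {V W : Man} (h : U ⟶ V) (g : V ⟶ W) : pullFunctor (h ≫ g) ≅ pullFunctor g ⋙ pullFunctor h :=
  NatIso.ofComponents (fun A =>
    mkIso (A := pullObj (h ≫ g) A) (B := pullObj h (pullObj g A)) ((pullComp h g).symm.app A.carrier)
      (pullCompHom h g A).map_mul (pullCompHom h g A).map_one (pullCompHom h g A).map_star)
    (fun f => by ext1; exact (pullComp h g).inv.naturality f.hom)

end StarMonoid

namespace StarMonoid

section
variable {V W X : Man} (f : U ⟶ V) (g : V ⟶ W) (k : W ⟶ X)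

theorem pullComp_assoc (A : StarMonoid X) :
    (pullCompIso (f ≫ g) k).hom.app A ≫ (pullCompIso f g).hom.app (pullObj k A) =
      (pullCompIso f (g ≫ k)).hom.app A ≫ (pullFunctor f).map ((pullCompIso g k).hom.app A) := by
  ext1
  change (pullComp (f ≫ g) k).inv.app A.carrier ≫ (pullComp f g).inv.app ((pull k).obj A.carrier) =
    (pullComp f (g ≫ k)).inv.app A.carrier ≫ (pull f).map ((pullComp g k).inv.app A.carrier)
  apply pull_ext
  intro Y a
  have h1 := congrArg (ap ((pullComp f g).inv.app ((pull k).obj A.carrier)) _) (pullComp_u (f ≫ g) k A.carrier a)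
  have h2 := pullComp_u f g ((pull k).obj A.carrier) (toPull k _ a)
  have h3 := congrArg (ap ((pull f).map ((pullComp g k).inv.app A.carrier)) _) (pullComp_u f (g ≫ k) A.carrier a)
  have h4 := u_nat f ((pullComp g k).inv.app A.carrier) (toPull (g ≫ k) A.carrier a)
  have h5 := congrArg (toPull f _) (pullComp_u g k A.carrier a)
  exact (h1.trans h2).trans ((h3.trans (h4.symm.trans h5)).symm)

theorem pullComp_id_right (A : StarMonoid V) :
    (pullCompIso f (𝟙 V)).hom.app A ≫ (pullFunctor f).map ((pullIdIso V).hom.app A) = 𝟙 (pullObj f A) := by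
  ext1
  change (pullComp f (𝟙 V)).inv.app A.carrier ≫ (pull f).map ((pullId V).hom.app A.carrier) = 𝟙 _
  apply pull_ext
  intro Y a
  have h3 := congrArg (ap ((pull f).map ((pullId V).hom.app A.carrier)) _) (pullComp_u f (𝟙 V) A.carrier a)
  have h4 := u_nat f ((pullId V).hom.app A.carrier) (toPull (𝟙 V) A.carrier a)
  have h5 := congrArg (toPull f _) (pullId_u A.carrier a)
  exact h3.trans (h4.symm.trans h5)

theorem pullComp_id_left (A : StarMonoid V) :
    (pullCompIso (𝟙 U) f).hom.app A ≫ (pullIdIso U).hom.app (pullObj f A) = 𝟙 (pullObj f A) := by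
  ext1
  change (pullComp (𝟙 U) f).inv.app A.carrier ≫ (pullId U).hom.app ((pull f).obj A.carrier) = 𝟙 _
  apply pull_ext
  intro Y a
  have h1 := congrArg (ap ((pullId U).hom.app ((pull f).obj A.carrier)) _) (pullComp_u (𝟙 U) f A.carrier a)
  exact h1.trans (pullId_u _ _)

end
end StarMonoid

theorem coherence_aux {C : Type*} [Category C] {P Q R S : C} (p : P ⟶ Q) (m : Q ⟶ R) (i : P ≅ S) (j : S ≅ R)
    (H : i.hom ≫ j.hom = p ≫ m) : p ≫ m ≫ 𝟙 R ≫ j.inv ≫ i.inv = 𝟙 P := by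
  rw [Category.id_comp, ← Category.assoc, ← H]
  simp

theorem coherence_aux' {C : Type*} [Category C] {P Q R : C} (p : P ⟶ Q) (m : Q ⟶ R) (n : P ⟶ R)
    (H : p ≫ m = n) : p ≫ m ≫ 𝟙 R = n := by
  rw [Category.comp_id, H]

/-- The prestack of smooth `*`-algebras: the pseudofunctor that sends `U` to the category of order-reversing
`*`-monoids in sheaves of modules over the smooth complex valued functions on `U`, and `h` to `h^*`. -/
def starAlg : Pseudofunctor (LocallyDiscrete Manᵒᵖ) Cat.{0, 1} :=
  LocallyDiscrete.mkPseudofunctor (fun U => Cat.of (StarMonoid U.unop))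
    (fun h => (StarMonoid.pullFunctor h.unop).toCatHom)
    (fun U => Cat.Hom.isoMk (StarMonoid.pullIdIso U.unop))
    (fun h g => Cat.Hom.isoMk (StarMonoid.pullCompIso g.unop h.unop))
    (fun f g k => by
      ext A
      exact coherence_aux _ _ ((StarMonoid.pullCompIso (k.unop ≫ g.unop) f.unop).app A)
        ((StarMonoid.pullCompIso k.unop g.unop).app _) (StarMonoid.pullComp_assoc k.unop g.unop f.unop A))
    (fun f => by
      ext A
      exact coherence_aux' _ _ _ (StarMonoid.pullComp_id_right f.unop A))
    (fun f => by
      ext A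
      exact coherence_aux' _ _ _ (StarMonoid.pullComp_id_left f.unop A))

/-- An open subset as a manifold. -/
def sub (U : Man) (W : Opens U.carrier) : Man where
  carrier := W
  dim := U.dim

/-- The inclusion of an open subset. -/
def incl {U : Man} (W : Opens U.carrier) : sub U W ⟶ U := (⟨Subtype.val, contMDiff_subtype_val (I := 𝓡 U.dim) (U := W)⟩ : Hom (sub U W) U)
/-- The inclusion of an open subset into a larger one. -/
def subIncl {U : Man} {W W' : Opens U.carrier} (h : W ≤ W') : sub U W ⟶ sub U W' := (⟨Opens.inclusion h, contMDiff_inclusion (I := 𝓡 U.dim) h⟩ : Hom (sub U W) (sub U W'))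

theorem subIncl_incl {W W' : Opens U.carrier} (h : W ≤ W') : subIncl h ≫ incl W' = incl W := rfl

/-- A smooth map with values in an open subset. -/
def subLift {Y : Man} {W : Opens U.carrier} (f : Y ⟶ U) (hf : ∀ y, Hom.toFun f y ∈ W) : Y ⟶ sub U W :=
  (⟨fun y => ⟨Hom.toFun f y, hf y⟩, (ContMDiff.subtypeVal_comp_iff (I' := 𝓡 U.dim) W _).1 (Hom.contMDiff f)⟩ : Hom Y (sub U W))

theorem subLift_incl {Y : Man} {W : Opens U.carrier} (f : Y ⟶ U) (hf : ∀ y, Hom.toFun f y ∈ W) : subLift f hf ≫ incl W = f := rfl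

theorem incl_mem {Y : Man} {W : Opens U.carrier} (f : Y ⟶ sub U W) (y) : Hom.toFun (f ≫ incl W) y ∈ W := (Hom.toFun f y).2

theorem incl_ext {Y : Man} {W : Opens U.carrier} {f g : Y ⟶ sub U W} (h : f ≫ incl W = g ≫ incl W) : f = g := by
  apply Hom.ext
  funext y
  exact Subtype.ext (congrFun (congrArg Hom.toFun h) y)

/-- The intersection of two open subsets, as their fibre product. -/
def inter₂ (V W : Opens U.carrier) : Limits.ChosenPullback (incl V) (incl W) where
  pullback := sub U (V ⊓ W)
  p₁ := subIncl inf_le_left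
  p₂ := subIncl inf_le_right
  condition := rfl
  isLimit := Limits.PullbackCone.IsLimit.mk _ (fun s => subLift (s.fst ≫ incl V) (fun y => ⟨incl_mem _ y, by
      rw [s.condition]; exact incl_mem _ y⟩))
    (fun s => incl_ext rfl)
    (fun s => incl_ext s.condition)
    (fun s m h1 _ => incl_ext (congrArg (fun k => k ≫ incl V) h1))
  p := incl (V ⊓ W)
  hp₁ := rfl

/-- The intersection of three open subsets, with its inclusions into the twofold intersections. -/
def inter₃ (V₁ V₂ V₃ : Opens U.carrier) : Limits.ChosenPullback₃ (inter₂ V₁ V₂) (inter₂ V₂ V₃) (inter₂ V₁ V₃) where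
  chosenPullback :=
    { pullback := sub U (V₁ ⊓ V₂ ⊓ V₃)
      p₁ := subIncl (W' := V₁ ⊓ V₂) inf_le_left
      p₂ := subIncl (W' := V₂ ⊓ V₃) (inf_le_inf_right _ inf_le_right)
      condition := rfl
      isLimit := Limits.PullbackCone.IsLimit.mk _
        (fun s => subLift (Limits.PullbackCone.fst s ≫ incl (V₁ ⊓ V₂)) (fun y => ⟨incl_mem _ y, by
          have h2 : Limits.PullbackCone.fst s ≫ incl (V₁ ⊓ V₂) = Limits.PullbackCone.snd s ≫ incl (V₂ ⊓ V₃) :=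
            congrArg (fun k => k ≫ incl V₂) s.condition
          rw [h2]; exact (incl_mem (W := V₂ ⊓ V₃) (Limits.PullbackCone.snd s) y).2⟩))
        (fun s => incl_ext (W := V₁ ⊓ V₂) rfl)
        (fun s => incl_ext (W := V₂ ⊓ V₃) (congrArg (fun k => k ≫ incl V₂) s.condition))
        (fun s m h1 _ => incl_ext (congrArg (fun k => k ≫ incl (V₁ ⊓ V₂)) h1)) }
  p := incl (V₁ ⊓ V₂ ⊓ V₃)
  p₁ := subIncl (inf_le_left.trans inf_le_left)
  p₃ := subIncl inf_le_right
  l := { f := subIncl (inf_le_inf_right _ inf_le_left), f_p₁ := rfl, f_p₂ := rfl, f_p := rfl }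
  hp₁ := rfl
  hp₃ := rfl

section
variable (F : Pseudofunctor (LocallyDiscrete Manᵒᵖ) Cat.{0, 1}) {ι : Type} (V : ι → Opens U.carrier)

/-- The descent category of `F` for open subsets `V i` of `U`: families of objects `x i` of `F (V i)` with
morphisms `φ i j` from `x i` to `x j`, both restricted to `V i ⊓ V j`, which satisfy the cocycle condition on all
threefold intersections and are the identity for `i = j` (hence are isomorphisms), up to the coherence
isomorphisms of `F`; its morphisms are the families of morphisms in the `F (V i)` that are compatible with the `φ i j`. -/
abbrev Descent : Type 1 := F.DescentData' (f := fun i => incl (V i)) (fun i j => inter₂ (V i) (V j)) (fun i j k => inter₃ (V i) (V j) (V k))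

/-- The canonical functor `F U ⥤ Descent F V`, by restriction to the `V i` and the coherence isomorphisms. -/
def toDescent : F.obj (.mk (op U)) ⥤ Descent F V :=
  F.toDescentData (fun i => incl (V i)) ⋙ Pseudofunctor.DescentData'.fromDescentDataFunctor F _ _

/-- `F` is a stack for the open cover topology: for each open cover of each manifold, the canonical functor to
the descent category is an equivalence of categories. -/
def IsStack : Prop := ∀ (U : Man) (ι : Type) (V : ι → Opens U.carrier), ⨆ i, V i = ⊤ → (toDescent F V).IsEquivalence
end

end Man

end

noncomputable section

namespace Man

/-! Descent for `*`-algebras is descent for sheaves of modules, with the algebra structure carried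
along. The inverse image is only known as a left adjoint, so the first task is to compute it on open
submanifolds. Along an open immersion `h` it is plain restriction: for `X` inside the image of `h`,
the unit `A(X) → (h^* A)(h⁻¹ X)`, `a ↦ a ⊗ 1`, is bijective (`IsOpenImm.toPull_bijective`). After
that everything can be checked on sections.

The bookkeeping rests on the relation `Carries ψ a b`: the morphism `ψ` between restrictions to `T`
sends the restriction of `a` to that of `b`. It respects all algebraic operations, is local in the
open set `X`, composes, and is compatible with further restriction. The coherence isomorphisms
therefore enter only a few lemmas. For the transition morphisms `φ i j` of a descent datum, the
identity and cocycle conditions make `Carries` reflexive, transitive and symmetric, as far as the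
overlaps permit.

Fully faithful: by the sheaf property and the bijectivity above, sections of `B` over `X` are
exactly the compatible families of sections of the `B|_{W i}` (`toIncl_jointly_injective`,
`exists_toIncl`). A morphism is thus the same as a compatible family of local ones.

Essentially surjective: the glued object has as sections over `X` the families `s i` of sections of
`A_i` over `X ∩ W i` with `φ i j (s i) = s j` on overlaps. Operations are componentwise because the
`φ i j` are morphisms of `*`-monoids, and the sheaf axioms hold because compatibility is local. For
`X ⊆ W i` a family is determined by its `i`-th component, which can be arbitrary
(`comps_bijective`), so the glued object restricts to `A_i` on `W i`. -/

variable {U V : Man}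

/-! ### Inverse images along open immersions -/

/-- Open immersions of manifolds: open embeddings with smooth local inverses. -/
structure IsOpenImm (h : U ⟶ V) : Prop where
  isOpenEmbedding : Topology.IsOpenEmbedding (Hom.toTop h)
  exists_inverse : ∀ Y : Opens U.toTop, ∃ σ : sub V (isOpenEmbedding.functor.obj Y) ⟶ sub U Y,
    σ ≫ incl Y ≫ h = incl _

theorem isOpenImm_incl (W : Opens U.carrier) : IsOpenImm (incl W) where
  isOpenEmbedding := W.isOpenEmbedding'
  exists_inverse Y := ⟨subLift (subLift (incl _) (by rintro ⟨_, y, hy, rfl⟩; exact y.2))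
    (by rintro ⟨_, y, hy, rfl⟩; exact hy), rfl⟩

theorem isOpenImm_subIncl {W W' : Opens U.carrier} (i : W ≤ W') : IsOpenImm (subIncl i) where
  isOpenEmbedding := (Opens.isOpenEmbedding_of_le i)
  exists_inverse Y := ⟨subLift (subLift (incl _ ≫ incl _) (by rintro ⟨_, y, hy, rfl⟩; exact y.2))
    (by rintro ⟨_, y, hy, rfl⟩; exact hy), rfl⟩

namespace IsOpenImm
variable {h : U ⟶ V} (hh : IsOpenImm h)
include hh

/-- The image of an open subset. -/
abbrev im (Y : Opens U.toTop) : Opens V.toTop := hh.isOpenEmbedding.functor.obj Y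

theorem le_pre_im (Y : Opens U.toTop) : Y ≤ pre h (hh.im Y) := fun y hy => ⟨y, hy, rfl⟩

theorem pre_im_le (Y : Opens U.toTop) : pre h (hh.im Y) ≤ Y := by
  rintro y ⟨z, hz, e⟩
  rwa [← hh.isOpenEmbedding.injective e]

theorem im_pre_le (X : Opens V.toTop) : hh.im (pre h X) ≤ X := by
  rintro _ ⟨y, hy, rfl⟩
  exact hy

/-- Pullback of functions from the image of an open subset. -/
def fn (Y : Opens U.toTop) : V.Fn (hh.im Y) →+* U.Fn Y := (fres (hh.le_pre_im Y)).comp (fpull h (hh.im Y))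

/-- Points of the image have the form `h y`, so a function there is determined by its pullback.
Conversely a function on `Y` descends by composing it with the smooth local inverse. -/
theorem fn_bijective (Y : Opens U.toTop) : Function.Bijective (hh.fn Y) := by
  constructor
  · intro f g e
    refine ContMDiffMap.ext (f := f) (g := g) ?_
    rintro ⟨_, y, hy, rfl⟩
    exact congrArg (fun k : C^∞⟮𝓡 (sub U Y).dim, (sub U Y).carrier; 𝓘(ℝ, ℂ), ℂ⟯ => k ⟨y, hy⟩) e
  · intro f
    obtain ⟨σ, hσ⟩ := hh.exists_inverse Y
    let f' : C^∞⟮𝓡 (sub U Y).dim, (sub U Y).carrier; 𝓘(ℝ, ℂ), ℂ⟯ := f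
    let σ' : C^∞⟮𝓡 (sub V (hh.im Y)).dim, (sub V (hh.im Y)).carrier; 𝓡 (sub U Y).dim, (sub U Y).carrier⟯ := ⟨Hom.toFun σ, Hom.contMDiff σ⟩
    refine ⟨f'.comp σ', ?_⟩
    refine ContMDiffMap.ext (f := hh.fn Y (f'.comp σ')) (g := f') ?_
    rintro ⟨y, hy⟩
    change f' (Hom.toFun σ ⟨Hom.toFun h y, _⟩) = f' ⟨y, hy⟩
    congr 1
    -- The local inverse sends `h y` to `y`, because both have the same image under the injective
    -- map `h`.
    apply Subtype.ext
    apply hh.isOpenEmbedding.injective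
    exact congrFun (congrArg Hom.toFun hσ) ⟨Hom.toFun h y, ⟨y, hy, rfl⟩⟩

/-- Functions on an open subset as functions on its image. -/
def fnEquiv (Y : Opens U.toTop) : V.Fn (hh.im Y) ≃+* U.Fn Y := RingEquiv.ofBijective (hh.fn Y) (hh.fn_bijective Y)

theorem fnEquiv_apply (Y : Opens U.toTop) (f : V.Fn (hh.im Y)) :
    hh.fnEquiv Y f = fres (hh.le_pre_im Y) (fpull h (hh.im Y) f) := rfl

theorem fnEquiv_symm_res {Y Y' : Opens U.toTop} (i : Y ≤ Y') (f : U.Fn Y') :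
    (hh.fnEquiv Y).symm (fres i f) = fres (hh.isOpenEmbedding.functor.monotone i) ((hh.fnEquiv Y').symm f) := by
  rw [RingEquiv.symm_apply_eq, fnEquiv_apply, fres_fpull, fres_fres]
  conv_lhs => rw [← (hh.fnEquiv Y').apply_symm_apply f]
  rw [fnEquiv_apply, fres_fres]

theorem fnEquiv_symm_fpull {X : Opens V.toTop} (f : V.Fn X) :
    (hh.fnEquiv _).symm (fpull h X f) = fres (hh.im_pre_le X) f := by
  rw [RingEquiv.symm_apply_eq, fnEquiv_apply, fres_fpull, fres_fres]
  rfl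

/-- Functions on `U` as functions on the image, as a morphism of sheaves of rings. -/
def onImO : haveI := hh.isOpenEmbedding.functor_isContinuous
    U.O ⟶ (hh.isOpenEmbedding.functor.sheafPushforwardContinuous RingCat.{0}
      (Opens.grothendieckTopology U.toTop) (Opens.grothendieckTopology V.toTop)).obj V.O :=
  haveI := hh.isOpenEmbedding.functor_isContinuous
  ⟨{ app := fun Y => RingCat.ofHom (hh.fnEquiv Y.unop).symm.toRingHom
     naturality := fun Y Y' i => by
       ext f
       exact hh.fnEquiv_symm_res i.unop.le f }⟩

/-- The restriction of a sheaf of modules along an open immersion, `Y ↦ A(h(Y))`. -/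
def restr (A : V.Sh) : U.Sh :=
  haveI := hh.isOpenEmbedding.functor_isContinuous
  (SheafOfModules.pushforward (F := hh.isOpenEmbedding.functor) hh.onImO).obj A

variable (A : V.Sh)

/-- Sections of the restriction are sections over the image. -/
def restrSec {Y : Opens U.toTop} : Sec (hh.restr A) Y ≃+ Sec A (hh.im Y) :=
  haveI := hh.isOpenEmbedding.functor_isContinuous
  AddEquiv.refl (Sec A (hh.im Y))

theorem restrSec_smul {Y : Opens U.toTop} (f : U.Fn Y) (a : Sec (hh.restr A) Y) :
    hh.restrSec A (f • a) = (hh.fnEquiv Y).symm f • hh.restrSec A a := rfl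

theorem restrSec_symm_smul {Y : Opens U.toTop} (f : V.Fn (hh.im Y)) (a : Sec A (hh.im Y)) :
    (hh.restrSec A).symm (f • a) = hh.fnEquiv Y f • (hh.restrSec A).symm a := by
  rw [AddEquiv.symm_apply_eq, restrSec_smul, RingEquiv.symm_apply_apply, AddEquiv.apply_symm_apply]

theorem restrSec_res {Y Y' : Opens U.toTop} (i : Y ≤ Y') (a : Sec (hh.restr A) Y') :
    hh.restrSec A (res _ i a) = res A (hh.isOpenEmbedding.functor.monotone i) (hh.restrSec A a) := rfl

theorem restrSec_symm_res {Y Y' : Opens U.toTop} (i : Y ≤ Y') (a : Sec A (hh.im Y')) :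
    (hh.restrSec A).symm (res A (hh.isOpenEmbedding.functor.monotone i) a) = res _ i ((hh.restrSec A).symm a) := rfl

/-- The morphism from the inverse image to the restriction. -/
def pullToRestr : (pull h).obj A ⟶ hh.restr A :=
  mkPull h (fun X a => (hh.restrSec A).symm (res A (hh.im_pre_le X) a))
    (fun X a b => by rw [map_add, map_add])
    (fun X f a => by
      rw [res_smul, ← fnEquiv_symm_fpull, restrSec_symm_smul, RingEquiv.apply_symm_apply])
    (fun X X' i a => by
      rw [← restrSec_symm_res, res_res, res_res])

theorem pullToRestr_u {X : Opens V.toTop} (a : Sec A X) :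
    hh.restrSec A (ap (hh.pullToRestr A) _ (toPull h A a)) = res A (hh.im_pre_le X) a := by
  rw [← AddEquiv.eq_symm_apply]
  exact mkPull_u ..

/-- The morphism from the restriction to the inverse image. -/
def restrToPull : hh.restr A ⟶ (pull h).obj A :=
  mkHom (fun Y =>
    { toFun := fun a => res _ (hh.le_pre_im Y) (toPull h A (hh.restrSec A a))
      map_add' := fun a b => by rw [map_add, map_add, map_add]
      map_smul' := fun f a => by
        rw [restrSec_smul, u_smul, res_smul, ← fnEquiv_apply, RingEquiv.apply_symm_apply, RingHom.id_apply] })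
    (fun Y Y' i a => by
      rw [LinearMap.coe_mk, AddHom.coe_mk, LinearMap.coe_mk, AddHom.coe_mk, restrSec_res, u_res, res_res, res_res])

theorem restrToPull_apply {Y : Opens U.toTop} (a : Sec (hh.restr A) Y) :
    ap (hh.restrToPull A) Y a = res _ (hh.le_pre_im Y) (toPull h A (hh.restrSec A a)) := rfl

/-- Both sides agree on the generators `a ⊗ 1`. This composite suffices for surjectivity in
`toPull_bijective`; injectivity there uses the formula `pullToRestr_u` instead of the other
composite. -/
theorem pullToRestr_restrToPull : hh.pullToRestr A ≫ hh.restrToPull A = 𝟙 _ := by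
  apply pull_ext
  intro X a
  rw [ap_comp, restrToPull_apply, pullToRestr_u, u_res, res_res, res_self, ap_id]

/-- Every section of the inverse image along an open immersion comes from the image. -/
theorem exists_toPull (Y : Opens U.toTop) (s : Sec ((pull h).obj A) Y) :
    ∃ a : Sec A (hh.im Y), res _ (hh.le_pre_im Y) (toPull h A a) = s :=
  ⟨hh.restrSec A (ap (hh.pullToRestr A) Y s), congrArg (fun τ => ap τ Y s) (hh.pullToRestr_restrToPull A)⟩

/-- The concrete form of "inverse image is restriction". The condition on `X` says that `X` lies in
the range of `h`, so that `X` and `im (pre h X)` coincide. -/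
theorem toPull_bijective (X : Opens V.toTop) (hX : ∀ x ∈ X, ∃ y, Hom.toFun h y = x) :
    Function.Bijective (toPull h A (W := X)) := by
  have hX' : X ≤ hh.im (pre h X) := fun x hx => by
    obtain ⟨y, rfl⟩ := hX x hx
    exact ⟨y, hx, rfl⟩
  constructor
  · intro a b e
    -- The map `pullToRestr` turns `a ⊗ 1` back into the restriction of `a` to `im (pre h X)`, which
    -- contains `X`; restricting to `X` recovers `a`.
    have := congrArg (fun s => res A hX' (hh.restrSec A (ap (hh.pullToRestr A) _ s))) e
    simpa only [pullToRestr_u, res_res, res_self] using this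
  · intro s
    obtain ⟨a, ha⟩ := hh.exists_toPull A _ s
    refine ⟨res A hX' a, ?_⟩
    rw [u_res]
    exact ha

end IsOpenImm

/-! ### The sheaf axioms on sections -/

theorem res_injective_of_cover (A : U.Sh) {ι : Type} {X : Opens U.toTop} {W : ι → Opens U.toTop} (hW : ∀ i, W i ≤ X)
    (cover : X ≤ iSup W) {a b : Sec A X} (h : ∀ i, res A (hW i) a = res A (hW i) b) : a = b :=
  TopCat.Sheaf.eq_of_locally_eq' (C := Ab) ⟨A.val.presheaf, A.isSheaf⟩ W X (fun i => homOfLE (hW i)) cover a b h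

theorem exists_glue (A : U.Sh) {ι : Type} {X : Opens U.toTop} {W : ι → Opens U.toTop} (hW : ∀ i, W i ≤ X)
    (cover : X ≤ iSup W) (s : ∀ i, Sec A (W i))
    (h : ∀ i j, res A (inf_le_left : W i ⊓ W j ≤ W i) (s i) = res A (inf_le_right : W i ⊓ W j ≤ W j) (s j)) :
    ∃ a : Sec A X, ∀ i, res A (hW i) a = s i := by
  have hc : TopCat.Presheaf.IsCompatible (C := Ab) (X := U.toTop) A.val.presheaf W s := h
  exact (TopCat.Sheaf.existsUnique_gluing' (C := Ab) ⟨A.val.presheaf, A.isSheaf⟩ W X (fun i => homOfLE (hW i)) cover s hc).exists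

/-- A sheaf of modules described by its sections. -/
structure SheafData (U : Man) where
  obj : Opens U.toTop → Type
  [grp : ∀ W, AddCommGroup (obj W)]
  [mod : ∀ W, Module (U.Fn W) (obj W)]
  res {V W} (h : V ≤ W) : obj W →+ obj V
  res_smul {V W} (h : V ≤ W) (f : U.Fn W) (a : obj W) : res h (f • a) = fres h f • res h a
  res_res {V W X} (h : V ≤ W) (k : W ≤ X) (a : obj X) : res h (res k a) = res (h.trans k) a
  res_self {W} (a : obj W) : res le_rfl a = a
  sep {ι : Type} (W : ι → Opens U.toTop) (a b : obj (iSup W)) (h : ∀ i, res (le_iSup W i) a = res (le_iSup W i) b) : a = b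
  glue {ι : Type} (W : ι → Opens U.toTop) (s : ∀ i, obj (W i))
    (h : ∀ i j, res (inf_le_left : W i ⊓ W j ≤ W i) (s i) = res (inf_le_right : W i ⊓ W j ≤ W j) (s j)) :
    ∃ a, ∀ i, res (le_iSup W i) a = s i

namespace SheafData
attribute [instance] grp mod
variable (D : SheafData U)

/-- The presheaf of abelian groups of `SheafData`. -/
def abPresheaf : (Opens U.toTop)ᵒᵖ ⥤ Ab where
  obj W := AddCommGrpCat.of (D.obj W.unop)
  map i := AddCommGrpCat.ofHom (D.res i.unop.le)
  map_id W := by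
    ext a
    exact D.res_self a
  map_comp i j := by
    ext a
    exact (D.res_res j.unop.le i.unop.le a).symm

instance (W : (Opens U.toTop)ᵒᵖ) : Module (U.O.obj.obj W) (D.abPresheaf.obj W) := D.mod W.unop

/-- The presheaf of modules of `SheafData`. -/
def presheaf : PresheafOfModules.{0} U.O.obj :=
  PresheafOfModules.ofPresheaf D.abPresheaf (fun _ _ i f a => D.res_smul i.unop.le f a)

/-- The sheaf of modules of `SheafData`. -/
def sheaf : U.Sh where
  val := D.presheaf
  isSheaf := by
    change TopCat.Presheaf.IsSheaf (C := Ab) _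
    rw [TopCat.Presheaf.isSheaf_iff_isSheafUniqueGluing]
    intro ι W s hs
    obtain ⟨a, ha⟩ := D.glue W s hs
    refine ⟨a, ha, fun b hb => ?_⟩
    exact D.sep W b a fun i => (hb i).trans (ha i).symm

/-- The sections of the sheaf. -/
def sec (W : Opens U.toTop) : Sec D.sheaf W ≃ₗ[U.Fn W] D.obj W := LinearEquiv.refl _ (D.obj W)

end SheafData

/-! ### Coherence isomorphisms on sections -/

/-- The descent category is phrased with the abstract isomorphisms `mapComp'`. For a literal
composite these are the `pullCompIso` from which `starAlg` is built, whose effect on `a ⊗ 1` is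
known. -/
theorem starAlg_mapComp'_hom {Y Z : Man} (h : U ⟶ Y) (g : Y ⟶ Z) (e : g.op.toLoc ≫ h.op.toLoc = (h ≫ g).op.toLoc)
    (A : StarMonoid Z) :
    (starAlg.mapComp' g.op.toLoc h.op.toLoc (h ≫ g).op.toLoc e).hom.toNatTrans.app A =
      (StarMonoid.pullCompIso h g).hom.app A := by
  rw [show starAlg.mapComp' g.op.toLoc h.op.toLoc (h ≫ g).op.toLoc e = starAlg.mapComp g.op.toLoc h.op.toLoc
    from Pseudofunctor.mapComp'_eq_mapComp ..]
  rfl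

theorem starAlg_mapComp'_inv {Y Z : Man} (h : U ⟶ Y) (g : Y ⟶ Z) (e : g.op.toLoc ≫ h.op.toLoc = (h ≫ g).op.toLoc)
    (A : StarMonoid Z) :
    (starAlg.mapComp' g.op.toLoc h.op.toLoc (h ≫ g).op.toLoc e).inv.toNatTrans.app A =
      (StarMonoid.pullCompIso h g).inv.app A := by
  rw [show starAlg.mapComp' g.op.toLoc h.op.toLoc (h ≫ g).op.toLoc e = starAlg.mapComp g.op.toLoc h.op.toLoc
    from Pseudofunctor.mapComp'_eq_mapComp ..]
  rfl

theorem pullComp_hom_u {Y Z : Man} (h : U ⟶ Y) (g : Y ⟶ Z) (A : Z.Sh) {X} (a : Sec A X) :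
    ap ((pullComp h g).hom.app A) _ (toPull h _ (toPull g A a)) = toPull (h ≫ g) A a := by
  rw [← pullComp_u h g A a]
  exact congrArg (fun τ => ap τ _ (toPull (h ≫ g) A a)) ((pullComp h g).inv_hom_id_app A)

theorem pullComp_hom_injective {Y Z : Man} (h : U ⟶ Y) (g : Y ⟶ Z) (A : Z.Sh) (X) :
    Function.Injective (ap ((pullComp h g).hom.app A) X) :=
  Function.LeftInverse.injective (g := ap ((pullComp h g).inv.app A) X)
    fun a => congrArg (fun τ => ap τ _ a) ((pullComp h g).hom_inv_id_app A)

/-- A general section of `g^* A` need not be of the form `a ⊗ 1`, so one application of `pull_ext`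
is not enough. The adjunction for `h` first yields morphisms out of `g^* A`, which are then tested
on its generators. -/
theorem pull_pull_ext {Y Z : Man} (h : U ⟶ Y) (g : Y ⟶ Z) {A : Z.Sh} {C : U.Sh} {κ τ : (pull h).obj ((pull g).obj A) ⟶ C}
    (H : ∀ X (a : Sec A X), ap κ _ (toPull h _ (toPull g A a)) = ap τ _ (toPull h _ (toPull g A a))) : κ = τ := by
  apply ((pullPushAdj h).homEquiv _ C).injective
  rw [Adjunction.homEquiv_unit, Adjunction.homEquiv_unit]
  apply pull_ext
  intro X a
  exact H X a

/-! ### Sections over open submanifolds and the relation `Carries` -/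

namespace StarMonoid

section
variable {T W₁ W₂ W₃ : Opens U.carrier} {i₁ : T ≤ W₁} {i₂ : T ≤ W₂} {i₃ : T ≤ W₃}
  {A : StarMonoid (sub U W₁)} {B : StarMonoid (sub U W₂)} {C : StarMonoid (sub U W₃)}

/-- The sections of `A` over the part of an open subset of `U` that lies in the open submanifold `W`. -/
abbrev SecOn {W : Opens U.carrier} (A : StarMonoid (sub U W)) (X : Opens U.toTop) : Type := Sec ((push (incl W)).obj A.carrier) X

/-- The restriction of a section to a smaller open submanifold. -/
def toSub {T W : Opens U.carrier} (i : T ≤ W) (A : StarMonoid (sub U W)) {X : Opens U.toTop} (a : SecOn A X) :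
    SecOn (pullObj (subIncl i) A) X := toPull (subIncl i) A.carrier (W := pre (incl W) X) a

/-- The action of a morphism on sections. -/
def apOn {W : Opens U.carrier} {A B : StarMonoid (sub U W)} (ψ : A ⟶ B) {X : Opens U.toTop} (a : SecOn A X) : SecOn B X :=
  ap ψ.hom (pre (incl W) X) a

/-- A morphism between restrictions to `T` sends the restriction of `a` to the restriction of `b`. -/
def Carries (ψ : pullObj (subIncl i₁) A ⟶ pullObj (subIncl i₂) B) {X : Opens U.toTop} (a : SecOn A X) (b : SecOn B X) : Prop :=
  apOn ψ (toSub i₁ A a) = toSub i₂ B b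

/-- Multiplication of sections. -/
def mulOn {W : Opens U.carrier} {A : StarMonoid (sub U W)} {X : Opens U.toTop} (a b : SecOn A X) : SecOn A X :=
  ap A.mul (pre (incl W) X) (tmul a b)

/-- The involution on sections. -/
def starOn {W : Opens U.carrier} {A : StarMonoid (sub U W)} {X : Opens U.toTop} (a : SecOn A X) : SecOn A X :=
  apc A.star (pre (incl W) X) a

/-- The unit section. -/
def oneOn {W : Opens U.carrier} (A : StarMonoid (sub U W)) (X : Opens U.toTop) : SecOn A X :=
  ap A.one (pre (incl W) X) (fnSec 1)

variable {ψ : pullObj (subIncl i₁) A ⟶ pullObj (subIncl i₂) B} {X Y : Opens U.toTop} {a a' : SecOn A X} {b b' : SecOn B X}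

theorem toSub_add (i : T ≤ W₁) (a a' : SecOn A X) : toSub i A (a + a') = toSub i A a + toSub i A a' := map_add _ _ _
theorem apOn_add {A B : StarMonoid (sub U T)} (ψ : A ⟶ B) (a a' : SecOn A X) : apOn ψ (a + a') = apOn ψ a + apOn ψ a' := map_add _ _ _
theorem toSub_zero (i : T ≤ W₁) : toSub i A (0 : SecOn A X) = 0 := map_zero _
theorem apOn_zero {A B : StarMonoid (sub U T)} (ψ : A ⟶ B) : apOn ψ (0 : SecOn A X) = 0 := map_zero _
theorem toSub_smul (i : T ≤ W₁) (f : U.Fn X) (a : SecOn A X) : toSub i A (f • a) = f • toSub i A a :=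
  u_smul (subIncl i) A.carrier (fpull (incl W₁) X f) _
theorem apOn_smul {A B : StarMonoid (sub U T)} (ψ : A ⟶ B) (f : U.Fn X) (a : SecOn A X) : apOn ψ (f • a) = f • apOn ψ a :=
  (ap ψ.hom (pre (incl T) X)).map_smul (fpull (incl T) X f) a
theorem toSub_res (i : T ≤ W₁) (k : Y ≤ X) (a : SecOn A X) : toSub i A (res _ k a) = res _ k (toSub i A a) :=
  u_res (subIncl i) A.carrier ((Opens.map (Hom.toTop (incl W₁))).monotone k) a
theorem apOn_res {A B : StarMonoid (sub U T)} (ψ : A ⟶ B) (k : Y ≤ X) (a : SecOn A X) : apOn ψ (res _ k a) = res _ k (apOn ψ a) :=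
  ap_res ψ.hom ((Opens.map (Hom.toTop (incl T))).monotone k) a
theorem toSub_mul (i : T ≤ W₁) (a a' : SecOn A X) : toSub i A (mulOn a a') = mulOn (toSub i A a) (toSub i A a') :=
  uu_mul (subIncl i) A _ _
theorem apOn_mul {A B : StarMonoid (sub U T)} (ψ : A ⟶ B) (a a' : SecOn A X) : apOn ψ (mulOn a a') = mulOn (apOn ψ a) (apOn ψ a') :=
  ψ.map_mul _ _ _
theorem toSub_star (i : T ≤ W₁) (a : SecOn A X) : toSub i A (starOn a) = starOn (toSub i A a) := uu_star (subIncl i) A _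
theorem apOn_star {A B : StarMonoid (sub U T)} (ψ : A ⟶ B) (a : SecOn A X) : apOn ψ (starOn a) = starOn (apOn ψ a) :=
  ψ.map_star _ _
theorem toSub_one (i : T ≤ W₁) : toSub i A (oneOn A X) = oneOn _ X := uu_one (subIncl i) A _
theorem apOn_one {A B : StarMonoid (sub U T)} (ψ : A ⟶ B) : apOn ψ (oneOn A X) = oneOn B X :=
  congrArg (fun τ => ap τ (pre (incl T) X) (fnSec 1)) ψ.map_one

/-- Restriction to `T` and `ψ` both preserve addition. The same argument for the other operations
below makes the compatible families of a descent datum closed under the whole `*`-algebra structure.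
-/
theorem Carries.add (h : Carries ψ a b) (h' : Carries ψ a' b') : Carries ψ (a + a') (b + b') := by
  rw [Carries, toSub_add, apOn_add, h, h', toSub_add]
theorem Carries.zero : Carries ψ (0 : SecOn A X) (0 : SecOn B X) := by
  rw [Carries, toSub_zero, apOn_zero, toSub_zero]
theorem Carries.smul (f : U.Fn X) (h : Carries ψ a b) : Carries ψ (f • a) (f • b) := by
  rw [Carries, toSub_smul, apOn_smul, h, toSub_smul]
theorem Carries.res (k : Y ≤ X) (h : Carries ψ a b) : Carries ψ (Man.res _ k a) (Man.res _ k b) := by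
  rw [Carries, toSub_res, apOn_res, h, toSub_res]
theorem Carries.mul (h : Carries ψ a b) (h' : Carries ψ a' b') : Carries ψ (mulOn a a') (mulOn b b') := by
  rw [Carries, toSub_mul, apOn_mul, h, h', toSub_mul]
theorem Carries.star (h : Carries ψ a b) : Carries ψ (starOn a) (starOn b) := by
  rw [Carries, toSub_star, apOn_star, h, toSub_star]
theorem Carries.one : Carries ψ (oneOn A X) (oneOn B X) := by
  rw [Carries, toSub_one, apOn_one, toSub_one]

theorem Carries.comp {ψ' : pullObj (subIncl i₂) B ⟶ pullObj (subIncl i₃) C} {c : SecOn C X}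
    (h : Carries ψ a b) (h' : Carries ψ' b c) : Carries (ψ ≫ ψ') a c :=
  (congrArg (apOn ψ') h).trans h'

/-- The condition says `X ∩ W₁ ⊆ T`, so passing from `W₁` to `T` discards no part of the domain of a
section. -/
theorem toSub_bijective (i : T ≤ W₁) (A : StarMonoid (sub U W₁)) (hX : ∀ x ∈ X, x ∈ W₁ → x ∈ T) :
    Function.Bijective (toSub (X := X) i A) :=
  (isOpenImm_subIncl i).toPull_bijective A.carrier (pre (incl W₁) X) fun x hx => ⟨⟨x.1, hX x.1 hx x.2⟩, rfl⟩

/-- When `X ∩ W₂ ⊆ T`, every section of `B` over the part of `X` in `T` is a unique restriction from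
`W₂`. With `Carries.unique`, the relation is then the graph of a map. -/
theorem Carries.exists (ψ : pullObj (subIncl i₁) A ⟶ pullObj (subIncl i₂) B) (a : SecOn A X) (hX : ∀ x ∈ X, x ∈ W₂ → x ∈ T) :
    ∃ b : SecOn B X, Carries ψ a b := by
  obtain ⟨b, hb⟩ := (toSub_bijective i₂ B hX).2 (apOn ψ (toSub i₁ A a))
  exact ⟨b, hb.symm⟩

theorem Carries.unique (h : Carries ψ a b) (h' : Carries ψ a b') (hX : ∀ x ∈ X, x ∈ W₂ → x ∈ T) : b = b' :=
  (toSub_bijective i₂ B hX).1 (h.symm.trans h')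

/-- The relation is an equality between two sections of one sheaf, hence local. -/
theorem Carries.of_cover {κ : Type} {Z : κ → Opens U.toTop} (hZ : ∀ k, Z k ≤ X) (cover : X ≤ iSup Z)
    (h : ∀ k, Carries ψ (Man.res _ (hZ k) a) (Man.res _ (hZ k) b)) : Carries ψ a b := by
  apply res_injective_of_cover _ hZ cover
  intro k
  have := h k
  rwa [Carries, toSub_res, apOn_res, toSub_res] at this

open Pseudofunctor LocallyDiscreteOpToCat in
/-- The restriction to a smaller open submanifold of a morphism between restrictions. -/
def pullSub {T' : Opens U.carrier} (k : T' ≤ T) (ψ : pullObj (subIncl i₁) A ⟶ pullObj (subIncl i₂) B) :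
    pullObj (subIncl (k.trans i₁)) A ⟶ pullObj (subIncl (k.trans i₂)) B :=
  pullHom (F := starAlg) (f₁ := subIncl i₁) (f₂ := subIncl i₂) (M₁ := A) (M₂ := B) ψ (subIncl k)
    (subIncl (k.trans i₁)) (subIncl (k.trans i₂)) rfl rfl

theorem pullSub_eq {T' : Opens U.carrier} (k : T' ≤ T) (ψ : pullObj (subIncl i₁) A ⟶ pullObj (subIncl i₂) B) :
    pullSub k ψ = (pullCompIso (subIncl k) (subIncl i₁)).hom.app A ≫ (pullFunctor (subIncl k)).map ψ ≫
      (pullCompIso (subIncl k) (subIncl i₂)).inv.app B := by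
  rw [← starAlg_mapComp'_hom _ _ rfl, ← starAlg_mapComp'_inv _ _ rfl]
  rfl

/-- The coherence isomorphism for restrictions, on sections. -/
def toSubTrans {T' : Opens U.carrier} (k : T' ≤ T) (i : T ≤ W₁) (A : StarMonoid (sub U W₁)) {X : Opens U.toTop}
    (a : SecOn (pullObj (subIncl k) (pullObj (subIncl i) A)) X) : SecOn (pullObj (subIncl (k.trans i)) A) X :=
  ap ((pullComp (subIncl k) (subIncl i)).hom.app A.carrier) (pre (incl T') X) a

theorem toSubTrans_injective {T' : Opens U.carrier} (k : T' ≤ T) (i : T ≤ W₁) (A : StarMonoid (sub U W₁)) :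
    Function.Injective (toSubTrans (X := X) k i A) :=
  pullComp_hom_injective (subIncl k) (subIncl i) A.carrier (pre (incl T') X)

theorem toSubTrans_toSub {T' : Opens U.carrier} (k : T' ≤ T) (i : T ≤ W₁) (a : SecOn A X) :
    toSubTrans k i A (toSub k (pullObj (subIncl i) A) (toSub i A a)) = toSub (k.trans i) A a :=
  pullComp_hom_u (subIncl k) (subIncl i) A.carrier (X := pre (incl W₁) X) a

/-- The first coherence isomorphism sends the one-step restriction of `a` to the two-step one, and
naturality of the unit moves `ψ` inside. The second coherence isomorphism remains, as `toSubTrans`.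
-/
theorem apOn_pullSub {T' : Opens U.carrier} (k : T' ≤ T) (ψ : pullObj (subIncl i₁) A ⟶ pullObj (subIncl i₂) B) (a : SecOn A X) :
    apOn (pullSub k ψ) (toSub (k.trans i₁) A a) =
      toSubTrans k i₂ B (toSub k (pullObj (subIncl i₂) B) (apOn ψ (toSub i₁ A a))) := by
  rw [pullSub_eq]
  have h1 := pullComp_u (subIncl k) (subIncl i₁) A.carrier (X := pre (incl W₁) X) a
  have h2 := u_nat (subIncl k) ψ.hom (W := pre (incl T) X) (toSub i₁ A a)
  exact congrArg (toSubTrans k i₂ B) ((congrArg (ap ((pull (subIncl k)).map ψ.hom) (pre (incl T') X)) h1).trans h2.symm)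

theorem Carries.pullSub {T' : Opens U.carrier} (k : T' ≤ T) (h : Carries ψ a b) : Carries (pullSub k ψ) a b := by
  rw [Carries, apOn_pullSub, h, toSubTrans_toSub]

/-- Since `X ∩ T ⊆ T'`, the further restriction to `T'` is injective on the sections involved, and
so is the coherence isomorphism. -/
theorem Carries.of_pullSub {T' : Opens U.carrier} (k : T' ≤ T) (h : Carries (StarMonoid.pullSub k ψ) a b)
    (hX : ∀ x ∈ X, x ∈ T → x ∈ T') : Carries ψ a b := by
  rw [Carries, apOn_pullSub, ← toSubTrans_toSub k i₂ b] at h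
  exact (toSub_bijective k _ hX).1 (toSubTrans_injective k i₂ B h)

end
end StarMonoid

/-- A morphism to a conjugate sheaf of modules from its action on sections. -/
def mkConj {A B : U.Sh} (φ : ∀ X, Sec A X → Sec B X) (add : ∀ X a b, φ X (a + b) = φ X a + φ X b)
    (smul : ∀ X (f : U.Fn X) a, φ X (f • a) = fconj X f • φ X a)
    (hres : ∀ X X' (i : X ≤ X') a, φ X (res A i a) = res B i (φ X' a)) : A ⟶ conj B :=
  mkHom (fun X => { toFun := φ X, map_add' := add X, map_smul' := smul X }) hres

theorem apc_mkConj {A B : U.Sh} (φ : ∀ X, Sec A X → Sec B X) (add smul hres) (X) (a : Sec A X) :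
    apc (mkConj φ add smul hres) X a = φ X a := rfl

/-! ### Identity and cocycle conditions on sections -/

namespace StarMonoid

section
variable {ι : Type} {W : ι → Opens U.carrier} (D : Descent starAlg W)

/-- The objects of a descent datum. -/
def dObj (i : ι) : StarMonoid (sub U (W i)) := D.obj i

/-- The morphisms of a descent datum. -/
def dHom (i j : ι) : pullObj (subIncl (inf_le_left : W i ⊓ W j ≤ W i)) (dObj D i) ⟶
    pullObj (subIncl (inf_le_right : W i ⊓ W j ≤ W j)) (dObj D j) := D.hom i j

open Pseudofunctor DescentData' LocallyDiscreteOpToCat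

/-- The identity condition lives on the diagonal `W i → W i ⊓ W i`, which for open subsets is an
inclusion, so that it is an instance of `pullSub`. -/
theorem pullSub_dHom_self (i : ι) : pullSub (le_inf le_rfl le_rfl) (dHom D i i) = 𝟙 (pullObj (subIncl le_rfl) (dObj D i)) := by
  refine Eq.trans ?_ (D.pullHom'_hom_self i)
  exact (pullHom'_eq_pullHom D.hom (incl (W i)) (𝟙 (sub U (W i))) (𝟙 (sub U (W i))) (subIncl (le_inf le_rfl le_rfl)) rfl rfl rfl rfl).symm

theorem pullSub_dHom_comp (i j k : ι) :
    pullSub (show W i ⊓ W j ⊓ W k ≤ W i ⊓ W j from inf_le_left) (dHom D i j) ≫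
      pullSub (show W i ⊓ W j ⊓ W k ≤ W j ⊓ W k from inf_le_inf_right _ inf_le_right) (dHom D j k) =
    pullSub (show W i ⊓ W j ⊓ W k ≤ W i ⊓ W k from inf_le_inf_right _ inf_le_left) (dHom D i k) := by
  have := D.pullHom'_hom_comp i j k
  rw [pullHom'₁₂_eq_pullHom_of_chosenPullback₃ (fun i j k => inter₃ (W i) (W j) (W k)),
    pullHom'₂₃_eq_pullHom_of_chosenPullback₃ (fun i j k => inter₃ (W i) (W j) (W k)),
    pullHom'₁₃_eq_pullHom_of_chosenPullback₃ (fun i j k => inter₃ (W i) (W j) (W k))] at this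
  exact this

variable {D} {X : Opens U.toTop} {i j k : ι} {a : SecOn (dObj D i) X} {b : SecOn (dObj D j) X} {c : SecOn (dObj D k) X}

/-- The identity condition gives "only if". For "if", `φ i i` carries `a` to some section, and by
the first direction that section is `a`. -/
theorem carries_dHom_self_iff {b : SecOn (dObj D i) X} : Carries (dHom D i i) a b ↔ a = b := by
  have key : ∀ b, Carries (dHom D i i) a b → a = b := by
    intro b h
    have h' := h.pullSub (le_inf le_rfl le_rfl)
    rw [pullSub_dHom_self] at h'
    exact (toSub_bijective le_rfl (dObj D i) fun _ _ h => h).1 h'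
  refine ⟨key b, ?_⟩
  rintro rfl
  obtain ⟨b, hb⟩ := Carries.exists (dHom D i i) a fun x _ h => ⟨h, h⟩
  have := key b hb
  rwa [← this] at hb

/-- The cocycle condition gives the relation only over the triple intersection. The condition on `X`
makes that the whole of `X ∩ W i ∩ W k`; elsewhere `b` would provide no information. -/
theorem Carries.dHom_trans (h : Carries (dHom D i j) a b) (h' : Carries (dHom D j k) b c)
    (hX : ∀ x ∈ X, x ∈ W i → x ∈ W k → x ∈ W j) : Carries (dHom D i k) a c := by
  have := (h.pullSub (show W i ⊓ W j ⊓ W k ≤ W i ⊓ W j from inf_le_left)).comp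
    (h'.pullSub (show W i ⊓ W j ⊓ W k ≤ W j ⊓ W k from inf_le_inf_right _ inf_le_right))
  rw [pullSub_dHom_comp] at this
  exact this.of_pullSub _ fun x hx h => ⟨⟨h.1, hX x hx h.1 h.2⟩, h.2⟩

end

/-! ### The glued `*`-monoid -/

section
variable {ι : Type} {W : ι → Opens U.carrier} (D : Descent starAlg W)

/-- The compatible families of sections of a descent datum. -/
def glueSec (X : Opens U.toTop) : Submodule (U.Fn X) (∀ i, SecOn (dObj D i) X) where
  carrier := { s | ∀ i j, Carries (dHom D i j) (s i) (s j) }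
  add_mem' h h' i j := (h i j).add (h' i j)
  zero_mem' _ _ := Carries.zero
  smul_mem' f _ h i j := (h i j).smul f

/-- The sheaf of compatible families of sections of a descent datum. -/
def glueData : SheafData U where
  obj X := glueSec D X
  res k :=
    { toFun := fun s => ⟨fun i => res _ k (s.1 i), fun i j => (s.2 i j).res k⟩
      map_zero' := Subtype.ext (funext fun i => map_zero _)
      map_add' := fun s t => Subtype.ext (funext fun i => map_add _ _ _) }
  res_smul k f s := Subtype.ext (funext fun i => res_smul _ _ _ _)
  res_res h k s := Subtype.ext (funext fun i => res_res _ _ _ _)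
  res_self s := Subtype.ext (funext fun i => res_self _ _ _)
  sep Z s t h := Subtype.ext (funext fun i => res_injective_of_cover _ (le_iSup Z) le_rfl
    fun k => congrFun (congrArg Subtype.val (h k)) i)
  glue Z s h := by
    -- Each component is glued in its own sheaf; compatibility of the results is then tested on the
    -- cover, where it is known.
    have H : ∀ i, ∃ a : SecOn (dObj D i) (iSup Z), ∀ k, res _ (le_iSup Z k) a = (s k).1 i := fun i =>
      exists_glue _ (le_iSup Z) le_rfl (fun k => (s k).1 i) (fun k l => congrFun (congrArg Subtype.val (h k l)) i)
    choose a ha using H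
    refine ⟨⟨a, fun i j => Carries.of_cover (le_iSup Z) le_rfl fun k => ?_⟩, fun k => Subtype.ext (funext fun i => ha i k)⟩
    rw [ha, ha]
    exact (s k).2 i j

/-- The sheaf of modules glued from a descent datum. -/
def glueSh : U.Sh := (glueData D).sheaf

variable {D} in
/-- The components of a section of the glued sheaf. -/
def comps {X : Opens U.toTop} (s : Sec (glueSh D) X) (i : ι) : SecOn (dObj D i) X := ((glueData D).sec X s).1 i

variable {D} in
/-- A section of the glued sheaf from its components. -/
def ofComps {X : Opens U.toTop} (s : ∀ i, SecOn (dObj D i) X) (hs : ∀ i j, Carries (dHom D i j) (s i) (s j)) :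
    Sec (glueSh D) X := ((glueData D).sec X).symm ⟨s, hs⟩

variable {X Y : Opens U.toTop}

@[simp] theorem comps_ofComps (s : ∀ i, SecOn (dObj D i) X) (hs) (i : ι) : comps (ofComps s hs) i = s i := rfl
theorem comps_carries (s : Sec (glueSh D) X) (i j : ι) : Carries (dHom D i j) (comps s i) (comps s j) :=
  ((glueData D).sec X s).2 i j
variable {D} in
theorem comps_ext {s t : Sec (glueSh D) X} (h : ∀ i, comps s i = comps t i) : s = t :=
  ((glueData D).sec X).injective (Subtype.ext (funext h))
@[simp] theorem comps_add (s t : Sec (glueSh D) X) (i : ι) : comps (s + t) i = comps s i + comps t i := rfl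
@[simp] theorem comps_smul (f : U.Fn X) (s : Sec (glueSh D) X) (i : ι) : comps (f • s) i = f • comps s i := rfl
@[simp] theorem comps_res (k : Y ≤ X) (s : Sec (glueSh D) X) (i : ι) : comps (res _ k s) i = res _ k (comps s i) := rfl

end

section
variable {W : Opens U.carrier} {A : StarMonoid (sub U W)} {X Y : Opens U.toTop}

theorem mulOn_add (a b b' : SecOn A X) : mulOn a (b + b') = mulOn a b + mulOn a b' :=
  (congrArg (ap A.mul (pre (incl W) X)) (tmul_add _ _ _)).trans (map_add _ _ _)
theorem add_mulOn (a a' b : SecOn A X) : mulOn (a + a') b = mulOn a b + mulOn a' b :=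
  (congrArg (ap A.mul (pre (incl W) X)) (add_tmul _ _ _)).trans (map_add _ _ _)
theorem mulOn_smul (f : U.Fn X) (a b : SecOn A X) : mulOn a (f • b) = f • mulOn a b :=
  (congrArg (ap A.mul (pre (incl W) X)) (tmul_smul (fpull (incl W) X f) _ _)).trans (map_smul _ _ _)
theorem smul_mulOn (f : U.Fn X) (a b : SecOn A X) : mulOn (f • a) b = f • mulOn a b :=
  (congrArg (ap A.mul (pre (incl W) X)) (smul_tmul (fpull (incl W) X f) _ _)).trans (map_smul _ _ _)
theorem mulOn_res (k : Y ≤ X) (a b : SecOn A X) : mulOn (res _ k a) (res _ k b) = res _ k (mulOn a b) :=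
  (A.mulBil).res' ((Opens.map (Hom.toTop (incl W))).monotone k) a b
theorem starOn_add (a b : SecOn A X) : starOn (a + b) = starOn a + starOn b := map_add _ _ _
theorem starOn_smul (f : U.Fn X) (a : SecOn A X) : starOn (f • a) = fconj X f • starOn a :=
  apc_smul A.star (pre (incl W) X) (fpull (incl W) X f) a
theorem starOn_res (k : Y ≤ X) (a : SecOn A X) : starOn (res _ k a) = res _ k (starOn a) :=
  apc_res A.star ((Opens.map (Hom.toTop (incl W))).monotone k) a
theorem oneOn_res (k : Y ≤ X) : res _ k (oneOn A X) = oneOn A Y :=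
  (ap_res A.one ((Opens.map (Hom.toTop (incl W))).monotone k) (fnSec 1)).symm

end

section
variable {ι : Type} {W : ι → Opens U.carrier} (D : Descent starAlg W)

/-- The multiplication of the glued sheaf. -/
def glueMul : Bil (glueSh D) (glueSh D) (glueSh D) where
  toFun X := LinearMap.mk₂ (U.Fn X)
    (fun s t => ofComps (fun i => mulOn (comps s i) (comps t i)) fun i j => (comps_carries D s i j).mul (comps_carries D t i j))
    (fun _ _ _ => comps_ext fun _ => add_mulOn _ _ _)
    (fun _ _ _ => comps_ext fun _ => smul_mulOn _ _ _)
    (fun _ _ _ => comps_ext fun _ => mulOn_add _ _ _)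
    (fun _ _ _ => comps_ext fun _ => mulOn_smul _ _ _)
  res' _ _ _ := comps_ext fun _ => mulOn_res _ _ _

/-- This formula and its analogues for the unit and the involution reduce each axiom of `glue` to
the same axiom in every `dObj D i`. -/
theorem comps_glueMul {X : Opens U.toTop} (s t : Sec (glueSh D) X) (i : ι) :
    comps (ap (lift (glueMul D)) X (tmul s t)) i = mulOn (comps s i) (comps t i) := by
  rw [lift_tmul]
  rfl

/-- The unit of the glued sheaf. -/
def glueOne : U.unitSh ⟶ glueSh D := mkUnit (ofComps (fun _ => oneOn _ _) fun _ _ => Carries.one)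

theorem comps_glueOne (X : Opens U.toTop) (i : ι) : comps (ap (glueOne D) X (fnSec 1)) i = oneOn _ X := by
  rw [res_one, glueOne, mkUnit_one, comps_res]
  exact oneOn_res le_top

/-- The involution of the glued sheaf. -/
def glueStar : glueSh D ⟶ conj (glueSh D) :=
  mkConj (fun _ s => ofComps (fun i => starOn (comps s i)) fun i j => (comps_carries D s i j).star)
    (fun _ _ _ => comps_ext fun _ => starOn_add _ _)
    (fun _ _ _ => comps_ext fun _ => starOn_smul _ _)
    (fun _ _ _ _ => comps_ext fun _ => starOn_res _ _)

theorem comps_glueStar {X : Opens U.toTop} (s : Sec (glueSh D) X) (i : ι) :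
    comps (apc (glueStar D) X s) i = starOn (comps s i) := by
  rw [glueStar, apc_mkConj, comps_ofComps]

/-- The `*`-monoid glued from a descent datum. -/
def glue : StarMonoid U where
  carrier := glueSh D
  mul := lift (glueMul D)
  one := glueOne D
  star := glueStar D
  mul_assoc X a b c := comps_ext fun i => by
    simp only [comps_glueMul]
    exact (dObj D i).mul_assoc _ _ _ _
  one_mul X a := comps_ext fun i => by
    rw [comps_glueMul, comps_glueOne]
    exact (dObj D i).one_mul _ _
  mul_one X a := comps_ext fun i => by
    rw [comps_glueMul, comps_glueOne]
    exact (dObj D i).mul_one _ _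
  star_star X a := comps_ext fun i => by
    rw [comps_glueStar, comps_glueStar]
    exact (dObj D i).star_star _ _
  star_one X := comps_ext fun i => by
    rw [comps_glueStar, comps_glueOne]
    exact (dObj D i).star_one _
  star_mul X a b := comps_ext fun i => by
    simp only [comps_glueMul, comps_glueStar]
    exact (dObj D i).star_mul _ _ _

end
end StarMonoid

/-- A morphism of sheaves of modules that is bijective on sections is an isomorphism. -/
def isoOfBijective {A B : U.Sh} (κ : A ⟶ B) (h : ∀ X, Function.Bijective (ap κ X)) : A ≅ B where
  hom := κ
  inv := mkHom (fun X => (LinearEquiv.ofBijective (ap κ X) (h X)).symm.toLinearMap) fun X Y k b => by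
    apply (h X).1
    rw [ap_res]
    exact ((LinearEquiv.ofBijective (ap κ X) (h X)).apply_symm_apply _).trans
      (congrArg (res B k) ((LinearEquiv.ofBijective (ap κ Y) (h Y)).apply_symm_apply b).symm)
  hom_inv_id := by
    ext X a
    exact (LinearEquiv.ofBijective (ap κ X) (h X)).symm_apply_apply a
  inv_hom_id := by
    ext X b
    exact (LinearEquiv.ofBijective (ap κ X) (h X)).apply_symm_apply b

/-- The two inequalities make `X` and `Y` equal, though not syntactically, and restricting back
undoes the map. -/
theorem res_injective_of_le (A : U.Sh) {X Y : Opens U.toTop} (k : Y ≤ X) (h : X ≤ Y) : Function.Injective (res A k) :=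
  Function.LeftInverse.injective (g := res A h) fun a => by rw [res_res, res_self]

/-! ### Restrictions of a `*`-monoid on `U` -/

namespace StarMonoid

section
variable {W T : Opens U.carrier} {X Y : Opens U.toTop}

/-- A section over `X` of a direct image from `W` only sees `X ∩ W`, which is contained in `Y`. -/
theorem res_secOn_injective (A : StarMonoid (sub U W)) (k : Y ≤ X) (hY : ∀ x ∈ X, x ∈ W → x ∈ Y) :
    Function.Injective (res ((push (incl W)).obj A.carrier) k) :=
  res_injective_of_le A.carrier ((Opens.map (Hom.toTop (incl W))).monotone k) fun x hx => hY x.1 hx x.2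

theorem apOn_pullFunctor_map (i : T ≤ W) {A B : StarMonoid (sub U W)} (f : A ⟶ B) (a : SecOn A X) :
    apOn ((pullFunctor (subIncl i)).map f) (toSub i A a) = toSub i B (apOn f a) :=
  (u_nat (subIncl i) f.hom (W := pre (incl W) X) a).symm

/-- The restriction of a section to an open submanifold. -/
def toIncl (W : Opens U.carrier) (A : StarMonoid U) {X : Opens U.toTop} (a : Sec A.carrier X) : SecOn (pullObj (incl W) A) X :=
  toPull (incl W) A.carrier a

theorem toIncl_res (A : StarMonoid U) (k : Y ≤ X) (a : Sec A.carrier X) : toIncl W A (res _ k a) = res _ k (toIncl W A a) :=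
  u_res (incl W) A.carrier k a

theorem toIncl_bijective (A : StarMonoid U) (hX : X ≤ W) : Function.Bijective (toIncl W A (X := X)) :=
  (isOpenImm_incl W).toPull_bijective A.carrier X fun x hx => ⟨⟨x, hX hx⟩, rfl⟩

theorem apOn_toIncl {A B : StarMonoid U} (f : A ⟶ B) (a : Sec A.carrier X) :
    apOn ((pullFunctor (incl W)).map f) (toIncl W A a) = toIncl W B (ap f.hom X a) :=
  (u_nat (incl W) f.hom a).symm

/-- The canonical isomorphism between iterated restrictions. -/
def restrIso {W₁ W₂ : Opens U.carrier} (i₁ : T ≤ W₁) (i₂ : T ≤ W₂) (A : StarMonoid U) :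
    pullObj (subIncl i₁) (pullObj (incl W₁) A) ⟶ pullObj (subIncl i₂) (pullObj (incl W₂) A) :=
  CategoryStruct.comp (Y := pullObj (incl T) A)
    ((pullCompIso (subIncl i₁) (incl W₁)).inv.app A) ((pullCompIso (subIncl i₂) (incl W₂)).hom.app A)

/-- Both two-step restrictions of a section of `A` correspond to its direct restriction to `T` under
the coherence isomorphisms. -/
theorem carries_restrIso {W₁ W₂ : Opens U.carrier} (i₁ : T ≤ W₁) (i₂ : T ≤ W₂) (A : StarMonoid U) (a : Sec A.carrier X) :
    Carries (restrIso i₁ i₂ A) (toIncl W₁ A a) (toIncl W₂ A a) := by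
  have h1 := pullComp_hom_u (subIncl i₁) (incl W₁) A.carrier a
  have h2 := pullComp_u (subIncl i₂) (incl W₂) A.carrier a
  have h3 := congrArg (ap ((pullComp (subIncl i₂) (incl W₂)).inv.app A.carrier) (pre (incl T) X)) h1
  exact h3.trans h2

end

/-! ### The canonical descent datum and full faithfulness -/

section
variable {ι : Type} {W : ι → Opens U.carrier} {X Y : Opens U.toTop}

/-- The transition morphisms of the canonical datum are composites of two `mapComp'` through the
restriction to `W i ⊓ W j`; the explicit types let the two factors be replaced separately. -/
theorem dHom_toDescent (A : StarMonoid U) (i j : ι) :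
    dHom ((toDescent starAlg W).obj A) i j = restrIso inf_le_left inf_le_right A :=
  congrArg₂ (fun (κ : pullObj (subIncl (inf_le_left : W i ⊓ W j ≤ W i)) (pullObj (incl (W i)) A) ⟶ pullObj (incl (W i ⊓ W j)) A)
    (τ : pullObj (incl (W i ⊓ W j)) A ⟶ pullObj (subIncl (inf_le_right : W i ⊓ W j ≤ W j)) (pullObj (incl (W j)) A)) =>
      CategoryStruct.comp κ τ)
    (starAlg_mapComp'_inv (subIncl (inf_le_left : W i ⊓ W j ≤ W i)) (incl (W i)) rfl A)
    (starAlg_mapComp'_hom (subIncl (inf_le_right : W i ⊓ W j ≤ W j)) (incl (W j)) rfl A)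

theorem carries_toDescent (A : StarMonoid U) (a : Sec A.carrier X) (i j : ι) :
    Carries (dHom ((toDescent starAlg W).obj A) i j) (toIncl (W i) A a) (toIncl (W j) A a) := by
  rw [dHom_toDescent]
  exact carries_restrIso _ _ A a

theorem le_iSup_inf (hW : ⨆ i, W i = ⊤) (X : Opens U.toTop) : X ≤ ⨆ i, X ⊓ W i := by
  intro x hx
  obtain ⟨i, hi⟩ := Opens.mem_iSup.1 (show x ∈ ⨆ i, W i from hW ▸ trivial)
  exact Opens.mem_iSup.2 ⟨i, hx, hi⟩

/-- Over `X ⊓ W i` restriction to `W i` is injective, and these sets cover `X`. -/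
theorem toIncl_jointly_injective (hW : ⨆ i, W i = ⊤) (A : StarMonoid U) {a b : Sec A.carrier X}
    (h : ∀ i, toIncl (W i) A a = toIncl (W i) A b) : a = b := by
  apply res_injective_of_cover A.carrier (fun i => (inf_le_left : X ⊓ W i ≤ X)) (le_iSup_inf hW X)
  intro i
  apply (toIncl_bijective A (inf_le_right : X ⊓ W i ≤ W i)).1
  rw [toIncl_res, toIncl_res, h]

/-- The gluing half of the identification of sections over `X` with compatible families: each `b i`
lifts to a section of `A` over `X ⊓ W i`, and compatibility makes the lifts agree on overlaps. -/
theorem exists_toIncl (hW : ⨆ i, W i = ⊤) (A : StarMonoid U) (b : ∀ i, SecOn (pullObj (incl (W i)) A) X)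
    (h : ∀ i j, Carries (dHom ((toDescent starAlg W).obj A) i j) (b i) (b j)) :
    ∃ a : Sec A.carrier X, ∀ i, toIncl (W i) A a = b i := by
  choose β hβ using fun i => (toIncl_bijective A (inf_le_right : X ⊓ W i ≤ W i)).2 (res _ inf_le_left (b i))
  obtain ⟨a, ha⟩ := exists_glue A.carrier (fun i => (inf_le_left : X ⊓ W i ≤ X)) (le_iSup_inf hW X) β fun i j => by
    apply (toIncl_bijective A (show (X ⊓ W i) ⊓ (X ⊓ W j) ≤ W j from inf_le_right.trans inf_le_right)).1
    -- On the overlap `φ i j` carries the restriction of `b i` both to the restriction of `β i` to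
    -- `W j` (as `β i` comes from `A`) and to that of `b j` (by hypothesis). By uniqueness `β i` and
    -- `β j` agree after restriction to `W j`, where restriction is injective.
    have h1 := carries_toDescent (W := W) A (res A.carrier (inf_le_left : (X ⊓ W i) ⊓ (X ⊓ W j) ≤ X ⊓ W i) (β i)) i j
    have h2 := (h i j).res (show (X ⊓ W i) ⊓ (X ⊓ W j) ≤ X from inf_le_left.trans inf_le_left)
    have h3 : toIncl (W i) A (res A.carrier (inf_le_left : (X ⊓ W i) ⊓ (X ⊓ W j) ≤ X ⊓ W i) (β i)) =
        res _ (show (X ⊓ W i) ⊓ (X ⊓ W j) ≤ X from inf_le_left.trans inf_le_left) (b i) := by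
      rw [toIncl_res, hβ, res_res]
    rw [h3] at h1
    rw [toIncl_res A _ (β j), hβ, res_res]
    exact h1.unique h2 fun x hx _ => ⟨hx.1.2, hx.2.2⟩
  refine ⟨a, fun i => ?_⟩
  apply res_secOn_injective _ (inf_le_left : X ⊓ W i ≤ X) fun x hx h => ⟨hx, h⟩
  rw [← toIncl_res, ha, hβ]

theorem hom_ext_of_pullFunctor_map (hW : ⨆ i, W i = ⊤) {A B : StarMonoid U} {f g : A ⟶ B}
    (h : ∀ i, (pullFunctor (incl (W i))).map f = (pullFunctor (incl (W i))).map g) : f = g := by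
  refine hom_ext (Man.hom_ext fun X a => toIncl_jointly_injective hW B fun i => ?_)
  rw [← apOn_toIncl, ← apOn_toIncl, h]

theorem toDescent_faithful (hW : ⨆ i, W i = ⊤) : (toDescent starAlg W).Faithful where
  map_injective e := hom_ext_of_pullFunctor_map hW fun i => congrArg (fun k => Pseudofunctor.DescentData'.Hom.hom k i) e

theorem comm_dHom {D D' : Descent starAlg W} (ψ : D ⟶ D') (i j : ι) :
    (pullFunctor (subIncl inf_le_left)).map (show dObj D i ⟶ dObj D' i from ψ.hom i) ≫ dHom D' i j =
    dHom D i j ≫ (pullFunctor (subIncl inf_le_right)).map (show dObj D j ⟶ dObj D' j from ψ.hom j) := ψ.comm i j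

/-- The commutation of `ψ` with the transition morphisms, read on sections. -/
theorem Carries.map {D D' : Descent starAlg W} (ψ : D ⟶ D') {i j : ι} {a : SecOn (dObj D i) X} {b : SecOn (dObj D j) X}
    (h : Carries (dHom D i j) a b) :
    Carries (dHom D' i j) (apOn (show dObj D i ⟶ dObj D' i from ψ.hom i) a) (apOn (show dObj D j ⟶ dObj D' j from ψ.hom j) b) := by
  rw [Carries, ← apOn_pullFunctor_map, ← apOn_pullFunctor_map, ← h]
  exact congrArg (fun κ => apOn κ (toSub inf_le_left (dObj D i) a)) (comm_dHom ψ i j)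

end

section
variable {W : Opens U.carrier} {X Y : Opens U.toTop} {A B : StarMonoid U}

theorem toIncl_add (a b : Sec A.carrier X) : toIncl W A (a + b) = toIncl W A a + toIncl W A b := map_add _ _ _
theorem toIncl_smul (f : U.Fn X) (a : Sec A.carrier X) : toIncl W A (f • a) = f • toIncl W A a := u_smul (incl W) A.carrier f a
theorem toIncl_mul (a b : Sec A.carrier X) : toIncl W A (ap A.mul X (tmul a b)) = mulOn (toIncl W A a) (toIncl W A b) :=
  uu_mul (incl W) A a b
theorem toIncl_star (a : Sec A.carrier X) : toIncl W A (apc A.star X a) = starOn (toIncl W A a) := uu_star (incl W) A a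
theorem toIncl_one : toIncl W A (ap A.one X (fnSec 1)) = oneOn _ X := uu_one (incl W) A X

end

section
variable {ι : Type} {W : ι → Opens U.carrier} {X Y : Opens U.toTop}

/-- The section `b` is unique by joint injectivity, so `a ↦ b` is a well-behaved map: linearity,
naturality and preservation of the structure can all be tested after restriction to each `W i`,
where they hold for `ψ i`. -/
theorem exists_hom (hW : ⨆ i, W i = ⊤) {A B : StarMonoid U} (ψ : ∀ i, pullObj (incl (W i)) A ⟶ pullObj (incl (W i)) B)
    (hψ : ∀ (X : Opens U.toTop) (a : Sec A.carrier X),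
      ∃ b : Sec B.carrier X, ∀ i, toIncl (W i) B b = apOn (ψ i) (toIncl (W i) A a)) :
    ∃ f : A ⟶ B, ∀ i, (pullFunctor (incl (W i))).map f = ψ i := by
  choose φ hφ using hψ
  let f : A ⟶ B :=
    { hom := mkHom (fun X =>
        { toFun := φ X
          map_add' := fun a b => toIncl_jointly_injective hW B fun i => by
            rw [toIncl_add, hφ, hφ, hφ, toIncl_add, apOn_add]
          map_smul' := fun g a => toIncl_jointly_injective hW B fun i => by
            rw [RingHom.id_apply, toIncl_smul, hφ, hφ, toIncl_smul, apOn_smul] })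
        (fun X Y k a => toIncl_jointly_injective hW B fun i => by
          rw [LinearMap.coe_mk, AddHom.coe_mk, LinearMap.coe_mk, AddHom.coe_mk, toIncl_res, hφ, hφ, toIncl_res, apOn_res])
      map_mul := fun X a b => toIncl_jointly_injective hW B fun i => by
        simp only [ap_mkHom, LinearMap.coe_mk, AddHom.coe_mk]
        rw [toIncl_mul, hφ, hφ, hφ, toIncl_mul, apOn_mul]
      map_one := unit_ext (toIncl_jointly_injective hW B fun i => by
        simp only [ap_comp, ap_mkHom, LinearMap.coe_mk, AddHom.coe_mk]
        rw [toIncl_one, hφ, toIncl_one, apOn_one])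
      map_star := fun X a => toIncl_jointly_injective hW B fun i => by
        simp only [ap_mkHom, LinearMap.coe_mk, AddHom.coe_mk]
        rw [toIncl_star, hφ, hφ, toIncl_star, apOn_star] }
  refine ⟨f, fun i => hom_ext (pull_ext _ fun X a => ?_)⟩
  exact (apOn_toIncl f a).trans (hφ X a i)

theorem exists_toDescent_map (hW : ⨆ i, W i = ⊤) {A B : StarMonoid U}
    (ψ : (toDescent starAlg W).obj A ⟶ (toDescent starAlg W).obj B) :
    ∃ f : A ⟶ B, ∀ i, (pullFunctor (incl (W i))).map f = ψ.hom i :=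
  exists_hom hW (fun i => ψ.hom i) fun _ a => exists_toIncl hW B _ fun i j => (carries_toDescent A a i j).map ψ

theorem toDescent_full (hW : ⨆ i, W i = ⊤) : (toDescent starAlg W).Full where
  map_surjective ψ := by
    obtain ⟨f, hf⟩ := exists_toDescent_map hW ψ
    exact ⟨f, Pseudofunctor.DescentData'.hom_ext hf⟩

/-! ### Effectivity of descent data -/

variable {D : Descent starAlg W}

theorem Carries.of_res {T W₁ W₂ : Opens U.carrier} {i₁ : T ≤ W₁} {i₂ : T ≤ W₂} {A : StarMonoid (sub U W₁)}
    {B : StarMonoid (sub U W₂)} {ψ : pullObj (subIncl i₁) A ⟶ pullObj (subIncl i₂) B} {a : SecOn A X} {b : SecOn B X}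
    (k : Y ≤ X) (hY : ∀ x ∈ X, x ∈ T → x ∈ Y) (h : Carries ψ (Man.res _ k a) (Man.res _ k b)) : Carries ψ a b := by
  apply res_secOn_injective _ k hY
  rwa [Carries, toSub_res, apOn_res, toSub_res] at h

/-- Over `X ⊓ W j` the morphism `φ j i` carries `b` to some `a'`. Transitivity through `j` shows
that `φ i i` carries `a` to `a'`, so `a' = a` there. Nothing is lost by shrinking `X`, since the
claim only concerns `X ∩ W j ∩ W i`. -/
theorem Carries.dHom_symm {i j : ι} {a : SecOn (dObj D i) X} {b : SecOn (dObj D j) X} (h : Carries (dHom D i j) a b) :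
    Carries (dHom D j i) b a := by
  apply Carries.of_res (inf_le_left : X ⊓ W j ≤ X) fun x hx (h : x ∈ W j ⊓ W i) => ⟨hx, h.1⟩
  obtain ⟨a', ha'⟩ := Carries.exists (dHom D j i) (Man.res _ (inf_le_left : X ⊓ W j ≤ X) b) fun x hx h => ⟨hx.2, h⟩
  have := (h.res (inf_le_left : X ⊓ W j ≤ X)).dHom_trans ha' fun x hx _ _ => hx.2
  rwa [← carries_dHom_self_iff.1 this] at ha'

/-- For `X ⊆ W i` every component is the image of the `i`-th one under `φ i j`. Conversely the
images of any `a` form a compatible family, because `φ j k` can be compared through `i`, and the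
`i`-th image is `a` itself by the identity condition. -/
theorem comps_bijective (i : ι) (hX : X ≤ W i) : Function.Bijective (fun s : Sec (glueSh D) X => comps s i) := by
  constructor
  · intro s t (e : comps s i = comps t i)
    refine comps_ext fun j => (comps_carries D s i j).unique ?_ fun x hx h => ⟨hX hx, h⟩
    rw [e]
    exact comps_carries D t i j
  · intro a
    choose b hb using fun j => Carries.exists (dHom D i j) a fun x hx h => ⟨hX hx, h⟩
    exact ⟨ofComps b fun j k => (hb j).dHom_symm.dHom_trans (hb k) fun x hx _ _ => hX hx,
      (carries_dHom_self_iff.1 (hb i)).symm⟩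

variable (D)

/-- The projection from the restriction of the glued sheaf. -/
def glueProj (i : ι) : (pull (incl (W i))).obj (glueSh D) ⟶ (dObj D i).carrier :=
  mkPull (incl (W i)) (fun _ s => comps s i) (fun _ _ _ => rfl) (fun _ _ _ => rfl) (fun _ _ _ _ => rfl)

theorem glueProj_u (i : ι) (s : Sec (glueSh D) X) : ap (glueProj D i) _ (toPull (incl (W i)) (glueSh D) s) = comps s i := mkPull_u ..

theorem glueProj_bijective (i : ι) (Y : Opens (sub U (W i)).toTop) : Function.Bijective (ap (glueProj D i) Y) := by
  obtain ⟨X, hX, rfl⟩ : ∃ X : Opens U.toTop, X ≤ W i ∧ pre (incl (W i)) X = Y :=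
    ⟨(isOpenImm_incl (W i)).im Y, by rintro _ ⟨y, -, rfl⟩; exact y.2,
      le_antisymm ((isOpenImm_incl (W i)).pre_im_le Y) ((isOpenImm_incl (W i)).le_pre_im Y)⟩
  -- For `X ⊆ W i` every section of the restricted glued sheaf is `s ⊗ 1` for a unique `s`. Since
  -- `glueProj` sends `s ⊗ 1` to its `i`-th component, bijectivity of the components passes to
  -- `glueProj`.
  have h : Function.Bijective (toPull (incl (W i)) (glueSh D) (W := X)) := toIncl_bijective (glue D) hX
  refine (Function.Bijective.of_comp_iff _ h).1 ?_
  rw [show ap (glueProj D i) (pre (incl (W i)) X) ∘ toPull (incl (W i)) (glueSh D) = fun s => comps (D := D) s i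
    from funext fun s => glueProj_u D i s]
  exact comps_bijective i hX

/-- The projection from the restriction of the glued `*`-monoid. -/
def glueHom (i : ι) : pullObj (incl (W i)) (glue D) ⟶ dObj D i :=
  homOfUU (A := glue D) (B := dObj D i) (incl (W i)) (glueProj D i) (fun _ s => comps s i) (fun _ s => glueProj_u D i s)
    (fun _ s t => comps_glueMul D s t i) (fun Z => comps_glueOne D Z i) (fun _ s => comps_glueStar D s i)

/-- The isomorphism from the restriction of the glued `*`-monoid to the given one. -/
def glueIso (i : ι) : pullObj (incl (W i)) (glue D) ≅ dObj D i :=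
  mkIso (A := pullObj (incl (W i)) (glue D)) (isoOfBijective (glueProj D i) (glueProj_bijective D i))
   (glueHom D i).map_mul (glueHom D i).map_one (glueHom D i).map_star

theorem apOn_glueIso (i : ι) (s : Sec (glue D).carrier X) :
    apOn (glueIso D i).hom (toIncl (W i) (glue D) s) = comps (D := D) s i :=
  glueProj_u D i s

/-- On a doubly restricted section `s` both sides reduce to the components of `s`, and the identity
becomes the compatibility `φ i j (s i) = s j` that defines the glued sheaf. -/
theorem glueIso_comm (i j : ι) :
    (pullFunctor (subIncl inf_le_left)).map (glueIso D i).hom ≫ dHom D i j =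
      restrIso inf_le_left inf_le_right (glue D) ≫ (pullFunctor (subIncl inf_le_right)).map (glueIso D j).hom := by
  refine hom_ext (pull_pull_ext _ (incl (W i)) fun X s => ?_)
  change apOn (dHom D i j) (apOn ((pullFunctor (subIncl _)).map (glueIso D i).hom) (toSub _ _ (toIncl (W i) (glue D) s))) =
    apOn ((pullFunctor (subIncl inf_le_right)).map (glueIso D j).hom)
      (apOn (restrIso inf_le_left inf_le_right (glue D)) (toSub _ _ (toIncl (W i) (glue D) s)))
  have h := carries_restrIso (inf_le_left : W i ⊓ W j ≤ W i) inf_le_right (glue D) s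
  rw [Carries] at h
  rw [h, apOn_pullFunctor_map, apOn_pullFunctor_map, apOn_glueIso, apOn_glueIso]
  exact comps_carries D s i j

/-- The family `W` is arbitrary: the glued object restricts to the given ones on the `W i` whether
or not these cover `U`. Covering matters only for full faithfulness. -/
theorem toDescent_essSurj : (toDescent starAlg W).EssSurj where
  mem_essImage D := ⟨glue D, ⟨Pseudofunctor.DescentData'.isoMk (fun i => glueIso D i) fun i j =>
    (glueIso_comm D i j).trans (congrArg (fun κ : pullObj (subIncl (inf_le_left : W i ⊓ W j ≤ W i)) (pullObj (incl (W i)) (glue D)) ⟶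
        pullObj (subIncl (inf_le_right : W i ⊓ W j ≤ W j)) (pullObj (incl (W j)) (glue D)) =>
      κ ≫ (pullFunctor (subIncl inf_le_right)).map (glueIso D j).hom) (dHom_toDescent (W := W) (glue D) i j).symm)⟩⟩

end
end StarMonoid

end Man

end

theorem mainTheorem8 : Man.IsStack Man.starAlg := by
  intro U ι W hW
  have := Man.StarMonoid.toDescent_faithful hW
  have := Man.StarMonoid.toDescent_full hW
  have := Man.StarMonoid.toDescent_essSurj (W := W)
  exact {}
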